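/- For a partition $\nu=(\nu_1\ge\dots\ge\nu_{l(\nu)}>0)$ write $|\nu|=\sum_i\nu_i$, let $m_j(\nu)$ be the number of parts equal to $j$, and put $$z_\nu=\prod_j m_j(\nu)!\,j^{m_j(\nu)},\qquad \kappa_\nu=|\nu|+\sum_i(\nu_i^2-2i\nu_i),$$ $$V_\nu(\lambda)=\prod_{1\le a<b\le l(\nu)}\frac{\sin[(\nu_a-\nu_b+b-a)\lambda/2]}{\sin[(b-a)\lambda/2]}\cdot\frac{1}{\prod_{i=1}^{l(\nu)}\prod_{v=1}^{\nu_i}2\sin[(v-i+l(\nu))\lambda/2]}.$$ For $|\nu|=|\mu|=d$ let $\chi_\nu(C(\mu))$ be the value of the irreducible character of the symmetric group $S_d$ indexed by $\nu$ on the conjugacy class $C(\mu)$ of permutations of cycle type $\mu$ (with $\nu=(d)$ indexing the trivial representation), and put $$W_\mu(\lambda;\tau)=\sum_{|\nu|=|\mu|}\frac{\chi_\nu(C(\mu))}{z_\mu}\,e^{\sqrt{-1}(\tau+\frac12)\kappa_\nu\lambda/2}\,V_\nu(\lambda),$$ a formal Laurent series in $\lambda$ with coefficients in $\mathbb C[\tau]$.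 With formal variables $p=(p_1,p_2,\dots)$ and $p_\mu=p_{\mu_1}\cdots p_{\mu_{l(\mu)}}$, define the formal power series in $p$ $$R^\bullet=\sum_{|\mu|\ge0}W_\mu(\lambda;\tau)\,p_\mu,\qquad R=\sum_{|\mu|\ge1}\Bigl(\sum_{n\ge1}\frac{(-1)^{n-1}}{n}\sum_{\mu^1\cup\dots\cup\mu^n=\mu}\ \prod_{i=1}^nW_{\mu^i}(\lambda;\tau)\Bigr)p_\mu,$$ where the inner sum runs over ordered $n$-tuples of nonempty partitions whose union is $\mu$. Theorem (cut-and-join equations). The following two equations hold: $$\frac{\partial R}{\partial\tau}=\frac{\sqrt{-1}\lambda}{2}\sum_{i,j\ge1}\Bigl(ij\,p_{i+j}\frac{\partial^2R}{\partial p_i\partial p_j}+ij\,p_{i+j}\frac{\partial R}{\partial p_i}\frac{\partial R}{\partial p_j}+(i+j)\,p_ip_j\frac{\partial R}{\partial p_{i+j}}\Bigr),$$ $$\frac{\partial R^\bullet}{\partial\tau}=\frac{\sqrt{-1}\lambda}{2}\sum_{i,j\ge1}\Bigl(ij\,p_{i+j}\frac{\partial^2R^\bullet}{\partial p_i\partial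 p_j}+(i+j)\,p_ip_j\frac{\partial R^\bullet}{\partial p_{i+j}}\Bigr).$$ In both equations the sum over $i,j$ is a formal sum: each monomial in $p$ occurs in only finitely many of its terms. -/

import Mathlib

namespace MarinoVafa

open scoped BigOperators Polynomial

noncomputable section

/-! ### Partitions -/

section Partitions

variable {d : ℕ}

/-- The parts of a partition, as a weakly decreasing list. -/
def rows (ν : Nat.Partition d) : List ℕ := ν.parts.sort (· ≥ ·)

/-- The number of parts `l(ν)`. -/
def len (ν : Nat.Partition d) : ℕ := (rows ν).length

/-- The `i`-th largest part `ν_i`, with indices starting at `1`. -/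
def part (ν : Nat.Partition d) (i : ℕ) : ℕ := (rows ν).getD (i - 1) 0

/-- `κ_ν = |ν| + ∑ i, (ν_i ^ 2 - 2 i ν_i)`. -/
def kappa (ν : Nat.Partition d) : ℤ :=
  (d : ℤ) + ∑ i ∈ Finset.Icc 1 (len ν), ((part ν i : ℤ) ^ 2 - 2 * (i : ℤ) * (part ν i : ℤ))

/-- `z_μ = ∏ j, m_j(μ)! * j ^ m_j(μ)`. -/
def zee (μ : Nat.Partition d) : ℕ :=
  ∏ j ∈ μ.parts.toFinset, (μ.parts.count j).factorial * j ^ (μ.parts.count j)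

theorem sum_rows (ν : Nat.Partition d) : ∑ i : Fin (len ν), (rows ν).get i = d := by
  have h : (rows ν).sum = d := by
    have h1 : ((rows ν : List ℕ) : Multiset ℕ) = ν.parts := Multiset.sort_eq _ _
    have h2 := congrArg Multiset.sum h1
    rw [ν.parts_sum] at h2
    simpa using h2
  have h3 : (List.ofFn (rows ν).get).sum = d := by rw [List.ofFn_get]; exact h
  rw [List.sum_ofFn] at h3
  exact h3

/-- The Young tableau of shape `ν` filled with the elements of `Fin d` in increasing order, row after
row: it sends `k` to its box, the pair of the row and the position in that row. -/
def tableau (ν : Nat.Partition d) : Fin d ≃ (i : Fin (len ν)) × Fin ((rows ν).get i) :=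
  (finCongr (sum_rows ν)).symm.trans finSigmaFinEquiv.symm

/-- The row (from `0`) of the box that contains `k`. -/
def rowOf (ν : Nat.Partition d) (k : Fin d) : ℕ := (tableau ν k).1

/-- The column (from `0`) of the box that contains `k`. -/
def colOf (ν : Nat.Partition d) (k : Fin d) : ℕ := (tableau ν k).2

end Partitions

/-! ### Irreducible characters of the symmetric group -/

section Characters

variable {d : ℕ}

/-- The row symmetrizer: the sum of the permutations that preserve each row. -/
def rowSymmetrizer (ν : Nat.Partition d) : MonoidAlgebra ℂ (Equiv.Perm (Fin d)) :=
  ∑ g : Equiv.Perm (Fin d) with ∀ k, rowOf ν (g k) = rowOf ν k, MonoidAlgebra.single g 1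

/-- The column antisymmetrizer: the signed sum of the permutations that preserve each column. -/
def colAntisymmetrizer (ν : Nat.Partition d) : MonoidAlgebra ℂ (Equiv.Perm (Fin d)) :=
  ∑ g : Equiv.Perm (Fin d) with ∀ k, colOf ν (g k) = colOf ν k,
    MonoidAlgebra.single g (((Equiv.Perm.sign g : ℤˣ) : ℤ) : ℂ)

/-- The irreducible module of `S_d` indexed by `ν`: the left ideal of the group algebra generated by
the Young symmetrizer. The partition `(d)` gives the trivial representation. -/
abbrev specht (ν : Nat.Partition d) : Ideal (MonoidAlgebra ℂ (Equiv.Perm (Fin d))) :=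
  Ideal.span {rowSymmetrizer ν * colAntisymmetrizer ν}

/-- The representation of `S_d` on `specht ν` by left multiplication. -/
def spechtRep (ν : Nat.Partition d) : Representation ℂ (Equiv.Perm (Fin d)) (specht ν) :=
  (Algebra.lsmul ℂ ℂ (specht ν)).toMonoidHom.comp
    (MonoidAlgebra.of ℂ (Equiv.Perm (Fin d)))

theorem exists_perm_parts (μ : Nat.Partition d) :
    ∃ g : Equiv.Perm (Fin d), g.partition.parts = μ.parts := by
  have hsplit : μ.parts.filter (2 ≤ ·) + Multiset.replicate (μ.parts.count 1) 1 = μ.parts := by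
    have h0 : μ.parts.filter (fun x => ¬ 2 ≤ x) = Multiset.replicate (μ.parts.count 1) 1 := by
      rw [← Multiset.filter_eq']
      refine Multiset.filter_congr fun x hx => ?_
      have := μ.parts_pos hx
      omega
    rw [← h0]
    exact Multiset.filter_add_not _ _
  have hs := congrArg Multiset.sum hsplit
  rw [Multiset.sum_add, Multiset.sum_replicate, μ.parts_sum, smul_eq_mul, mul_one] at hs
  obtain ⟨g, hg⟩ := (Equiv.Perm.exists_with_cycleType_iff (Fin d)
    (m := μ.parts.filter (2 ≤ ·))).mpr
      ⟨by rw [Fintype.card_fin]; omega, fun a ha => (Multiset.mem_filter.mp ha).2⟩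
  refine ⟨g, ?_⟩
  rw [Equiv.Perm.parts_partition, ← Equiv.Perm.sum_cycleType, hg, Fintype.card_fin]
  have h1 : d - (μ.parts.filter (2 ≤ ·)).sum = μ.parts.count 1 := by omega
  rw [h1]
  exact hsplit

/-- A permutation in the conjugacy class `C(μ)`, that is, with cycle lengths (fixed points
included) the parts of `μ`. -/
def permOfType (μ : Nat.Partition d) : Equiv.Perm (Fin d) := (exists_perm_parts μ).choose

/-- The value `χ_ν(C(μ))` of the irreducible character indexed by `ν` on the class `C(μ)`. -/
def chi (ν μ : Nat.Partition d) : ℂ :=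
  LinearMap.trace ℂ (specht ν) (spechtRep ν (permOfType μ))

end Characters

/-! ### The coefficients -/

/-- Formal Laurent series in `λ` with coefficients in `ℂ[τ]`. -/
abbrev Coeff : Type := LaurentSeries ℂ[X]

/-- The variable `λ`. -/
def lam : Coeff := HahnSeries.single 1 1

/-- `∂/∂τ`, acting on each coefficient of a Laurent series in `λ`. -/
def dTau (x : Coeff) : Coeff := HahnSeries.map x (Polynomial.derivative (R := ℂ))

/-- The Laurent series of `sin (n λ / 2)`. -/
def sinHalf (n : ℤ) : LaurentSeries ℂ :=
  HahnSeries.ofPowerSeries ℤ ℂ (PowerSeries.rescale ((n : ℂ) / 2) (PowerSeries.sin ℂ))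

/-- `V_ν(λ)`, in the field of Laurent series in `λ` over `ℂ`. -/
def V {d : ℕ} (ν : Nat.Partition d) : LaurentSeries ℂ :=
  (∏ a ∈ Finset.Icc 1 (len ν), ∏ b ∈ Finset.Ioc a (len ν),
    sinHalf ((part ν a : ℤ) - (part ν b : ℤ) + (b : ℤ) - (a : ℤ)) / sinHalf ((b : ℤ) - (a : ℤ))) *
  (∏ i ∈ Finset.Icc 1 (len ν), ∏ v ∈ Finset.Icc 1 (part ν i),
    2 * sinHalf ((v : ℤ) - (i : ℤ) + (len ν : ℤ)))⁻¹

/-- `exp (√-1 (τ + 1/2) κ_ν λ / 2)`, a power series in `λ` with coefficients in `ℂ[τ]`. -/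
def expKappa {d : ℕ} (ν : Nat.Partition d) : Coeff :=
  HahnSeries.ofPowerSeries ℤ ℂ[X]
    (PowerSeries.rescale
      (Polynomial.C (Complex.I * (kappa ν : ℂ) / 2) * (Polynomial.X + Polynomial.C (1 / 2)))
      (PowerSeries.exp ℂ[X]))

/-- `∑_{|ν| = |μ|} (χ_ν(C(μ)) / z_μ) exp (√-1 (τ + 1/2) κ_ν λ / 2) V_ν(λ)`. -/
def weight {d : ℕ} (μ : Nat.Partition d) : Coeff :=
  ∑ ν : Nat.Partition d,
    (chi ν μ / (zee μ : ℂ)) • (expKappa ν * HahnSeries.map (V ν) (Polynomial.C (R := ℂ)))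

/-! ### Formal power series in `p_1, p_2, …` -/

/-- Formal power series in the variables `p_i`, `i ≥ 1`. -/
abbrev PSeries : Type := MvPowerSeries ℕ+ Coeff

/-- The variable `p_i`. -/
def p (i : ℕ+) : PSeries := MvPowerSeries.X i

/-- `∂/∂p_i`. -/
def dP (i : ℕ+) (F : PSeries) : PSeries := MvPowerSeries.pderiv Coeff i F

/-- `∂/∂τ`, acting on each coefficient. -/
def dTauSeries (F : PSeries) : PSeries := fun m => dTau (MvPowerSeries.coeff m F)

/-- A family of power series is formally summable if each monomial occurs in only finitely many
members. -/
def FormallySummable {ι : Type} (f : ι → PSeries) : Prop :=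
  ∀ m, {i | MvPowerSeries.coeff m (f i) ≠ 0}.Finite

/-- The sum of a formally summable family, formed on each monomial. -/
def formalSum {ι : Type} (f : ι → PSeries) : PSeries :=
  fun m => ∑ᶠ i, MvPowerSeries.coeff m (f i)

/-- The partition `μ` with `p_μ = ∏ i, p_i ^ m i`: it has the part `i` with multiplicity `m i`. -/
def partitionOf (m : ℕ+ →₀ ℕ) :
    Nat.Partition ((Finsupp.toMultiset m).map (fun i : ℕ+ => (i : ℕ))).sum where
  parts := (Finsupp.toMultiset m).map (fun i : ℕ+ => (i : ℕ))
  parts_pos := by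
    intro i hi
    obtain ⟨a, -, rfl⟩ := Multiset.mem_map.mp hi
    exact a.pos
  parts_sum := rfl

/-- `R(λ; τ; p)^•`, the sum of `weight μ * p_μ` over all partitions `μ`, the empty one included. -/
def RBullet : PSeries := fun m => weight (partitionOf m)

/-- `R(λ; τ; p)`. The coefficient of `p_μ` is
`∑ n ≥ 1, ((-1) ^ (n - 1) / n) ∑_{μ^1 ∪ ⋯ ∪ μ^n = μ} ∏ i, weight (μ^i)`,
over the ordered `n`-tuples of nonempty partitions with union `μ`; partitions are written by their
multiplicities, so that the union is the sum. There are no such tuples for `n > l(μ)`, and none at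
all if `μ` is empty. -/
def RSeries : PSeries := fun m =>
  ∑ n ∈ Finset.Icc 1 m.degree, ((-1 : ℂ) ^ (n - 1) / (n : ℂ)) •
    ∑ t ∈ (Finset.piAntidiag (Finset.univ : Finset (Fin n)) m).filter (fun t => ∀ i, t i ≠ 0),
      ∏ i, weight (partitionOf (t i))

/-- The `(i, j)` term of the cut-and-join equation, for `i, j ≥ 1`. -/
def cutJoinTerm (F : PSeries) (ij : ℕ+ × ℕ+) : PSeries :=
  ((ij.1 : ℕ) * (ij.2 : ℕ) : PSeries) * p (ij.1 + ij.2) * dP ij.1 (dP ij.2 F) +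
  ((ij.1 : ℕ) * (ij.2 : ℕ) : PSeries) * p (ij.1 + ij.2) * (dP ij.1 F * dP ij.2 F) +
  ((ij.1 : ℕ) + (ij.2 : ℕ) : PSeries) * p ij.1 * p ij.2 * dP (ij.1 + ij.2) F

/-- The `(i, j)` term of the linear cut-and-join equation, for `i, j ≥ 1`. -/
def linearCutJoinTerm (F : PSeries) (ij : ℕ+ × ℕ+) : PSeries :=
  ((ij.1 : ℕ) * (ij.2 : ℕ) : PSeries) * p (ij.1 + ij.2) * dP ij.1 (dP ij.2 F) +
  ((ij.1 : ℕ) + (ij.2 : ℕ) : PSeries) * p ij.1 * p ij.2 * dP (ij.1 + ij.2) F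

/-- The scalar `√-1 λ / 2`. -/
def halfILam : Coeff := (Complex.I / 2) • lam

end

end MarinoVafa

namespace MarinoVafa

open scoped BigOperators Polynomial

noncomputable section

/-! ### Counting pairs of boxes of a Young diagram. -/

section Boxes

variable {d : ℕ} (ν : Nat.Partition d)

/-! Both equations come from one fact: the sum of all transpositions is central in the group algebra
of `S_d` and acts on the module indexed by `ν` as `κ_ν / 2`. Counting ordered pairs `(k, l)`,
diagonal included, turns this into the eigenvalue `κ_ν + d` of `swapSum`
(`swapSum_mul_of_mem_specht`). With the row symmetrizer `a` and the column antisymmetrizer `b`, the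
product `a (k l) b` for `k ≠ l` is `a b`, `-a b` or `0` as `k` and `l` share a row, a column or
neither, and `sum_ite_row_sub_col` counts such pairs.

Taking traces, `κ_ν χ_ν` becomes a sum of character values at `(x y) g` with `x ≠ y`. Such a product
joins two cycles of `g` or cuts one, and counting the pairs `(x, y)` by cycle lengths gives
`sum_swap_mul`. On the other side, `∂/∂τ` of the exponential factor produces `√-1 κ_ν λ / 2`
(`dTau_expKappa`). The two combine into a recursion for the numerators of the weights
(`dTau_weightNumerator`). The factors `1 / z_μ` turn its combinatorial coefficients into the
operators in the `p_i`: `coeff_cut_RBullet` and `coeff_join_RBullet` give the linear equation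
`dTauSeries_RBullet`.

For `R`, the defining sum is the logarithm of `R^•`, whose constant term is `1`. Hence `R^• · D R =
D R^•` for `D = ∂/∂τ` and `D = ∂/∂p_i` (`RBullet_mul_map_RSeries`). Multiplying the nonlinear
equation by the unit `R^•` then yields the linear one, term by term (`RBullet_mul_cutJoinTerm`). -/

/-- The length of row `i` (from `0`). -/
def rowLen (i : Fin (len ν)) : ℕ := (rows ν).get i

theorem sum_rowLen : ∑ i, rowLen ν i = d := sum_rows ν

theorem box_ext {k l : Fin d} (hr : rowOf ν k = rowOf ν l) (hc : colOf ν k = colOf ν l) :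
    k = l := by
  apply (tableau ν).injective
  unfold rowOf colOf at *
  generalize tableau ν k = x at *
  generalize tableau ν l = y at *
  obtain ⟨i, a⟩ := x
  obtain ⟨j, b⟩ := y
  have hij : i = j := Fin.ext hr
  subst hij
  have hab : a = b := Fin.ext hc
  rw [hab]

theorem rows_get_le {i j : Fin (len ν)} (h : i ≤ j) : rowLen ν j ≤ rowLen ν i := by
  have hs : (rows ν).Pairwise (· ≥ ·) := Multiset.pairwise_sort _ _
  rcases h.eq_or_lt with rfl | h
  · exact le_rfl
  · exact List.pairwise_iff_get.mp hs i j h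

/-- Rows weakly decrease in length, so a column that reaches the row of `l` meets every earlier row.
-/
theorem exists_box {i : ℕ} {l : Fin d} (h : i ≤ rowOf ν l) :
    ∃ m, rowOf ν m = i ∧ colOf ν m = colOf ν l := by
  have hi : i < len ν := lt_of_le_of_lt h (tableau ν l).1.isLt
  have hle := rows_get_le ν (i := ⟨i, hi⟩) (j := (tableau ν l).1) h
  refine ⟨(tableau ν).symm ⟨⟨i, hi⟩, ⟨colOf ν l, lt_of_lt_of_le (tableau ν l).2.isLt hle⟩⟩, ?_, ?_⟩
  · simp [rowOf]
  · unfold colOf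
    rw [Equiv.apply_symm_apply]

theorem sum_boxes {M : Type*} [AddCommMonoid M] (f : ℕ → ℕ → M) :
    ∑ k, f (rowOf ν k) (colOf ν k) =
      ∑ i : Fin (len ν), ∑ j : Fin (rowLen ν i), f i j := by
  let e : Fin d ≃ (i : Fin (len ν)) × Fin (rowLen ν i) := tableau ν
  exact (e.sum_comp (fun x => f x.1 x.2)).trans
    (Fintype.sum_sigma (fun x : (i : Fin (len ν)) × Fin (rowLen ν i) => f x.1 x.2))

theorem kappa_eq : kappa ν = (d : ℤ) + ∑ i : Fin (len ν),
    ((rowLen ν i : ℤ) ^ 2 - 2 * ((i : ℤ) + 1) * (rowLen ν i : ℤ)) := by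
  unfold kappa
  congr 1
  have h : Finset.Icc 1 (len ν) = (Finset.range (len ν)).map (addRightEmbedding 1) := by
    rw [Finset.range_eq_Ico, Finset.map_add_right_Ico]
    rfl
  rw [h, Finset.sum_map, Finset.sum_range]
  refine Finset.sum_congr rfl fun i _ => ?_
  have : part ν ((i : ℕ) + 1) = rowLen ν i := by
    unfold part
    simp only [Nat.add_sub_cancel]
    exact List.getD_eq_getElem _ _ i.isLt
  simp [this]

theorem sum_ite_row : ∑ k, ∑ l, (if rowOf ν k = rowOf ν l then (1 : ℤ) else 0) =
    ∑ i : Fin (len ν), (rowLen ν i : ℤ) ^ 2 := by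
  have h (k : Fin d) : ∑ l, (if rowOf ν k = rowOf ν l then (1 : ℤ) else 0) =
      ∑ i : Fin (len ν), if rowOf ν k = i then (rowLen ν i : ℤ) else 0 := by
    rw [sum_boxes ν (fun i _ => if rowOf ν k = i then (1 : ℤ) else 0)]
    refine Finset.sum_congr rfl fun i _ => ?_
    split_ifs <;> simp
  simp only [h]
  rw [sum_boxes ν (fun i' _ => ∑ i : Fin (len ν), if i' = i then (rowLen ν i : ℤ) else 0)]
  refine Finset.sum_congr rfl fun i _ => ?_
  simp [Fin.val_inj, sq]

theorem sum_ite_col_lt (l : Fin d) :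
    ∑ k, (if colOf ν k = colOf ν l ∧ rowOf ν k < rowOf ν l then (1 : ℤ) else 0) = rowOf ν l := by
  rw [Finset.sum_boole]
  norm_cast
  rw [← Finset.card_range (rowOf ν l)]
  refine Finset.card_bij (fun k _ => rowOf ν k) ?_ ?_ ?_
  · intro k hk
    simp at hk
    simpa using hk.2
  · intro k hk k' hk' h
    simp at hk hk'
    exact box_ext ν h (hk.1.trans hk'.1.symm)
  · intro i hi
    simp at hi
    obtain ⟨m, hm, hm'⟩ := exists_box ν hi.le
    exact ⟨m, by simp [hm, hm', hi], hm⟩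

/-- A pair in a common column is diagonal or has one box strictly above the other; a box in row `i`
(from `0`) has exactly `i` boxes above it. -/
theorem sum_ite_col : ∑ k, ∑ l, (if colOf ν k = colOf ν l then (1 : ℤ) else 0) =
    d + 2 * ∑ i : Fin (len ν), (i : ℤ) * (rowLen ν i : ℤ) := by
  have h (k l : Fin d) : (if colOf ν k = colOf ν l then (1 : ℤ) else 0) =
      (if k = l then 1 else 0) +
      (if colOf ν k = colOf ν l ∧ rowOf ν k < rowOf ν l then (1 : ℤ) else 0) +
      (if colOf ν l = colOf ν k ∧ rowOf ν l < rowOf ν k then (1 : ℤ) else 0) := by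
    by_cases hc : colOf ν k = colOf ν l
    · rcases lt_trichotomy (rowOf ν k) (rowOf ν l) with hr | hr | hr
      · have : k ≠ l := by rintro rfl; exact lt_irrefl _ hr
        simp [hc, hr, this, hr.not_gt]
      · simp [box_ext ν hr hc]
      · have : k ≠ l := by rintro rfl; exact lt_irrefl _ hr
        simp [hc, hr, this, hr.not_gt]
    · have : k ≠ l := by rintro rfl; exact hc rfl
      simp [hc, Ne.symm hc, this]
  simp only [h, Finset.sum_add_distrib, sum_ite_col_lt]
  rw [Finset.sum_comm (f := fun k l =>
    if colOf ν k = colOf ν l ∧ rowOf ν k < rowOf ν l then (1 : ℤ) else 0)]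
  simp only [sum_ite_col_lt]
  rw [sum_boxes ν (fun i _ => (i : ℤ))]
  simp [mul_comm]
  ring

/-- The summand is the scalar by which `swap k l` acts between the two symmetrizers; the last
indicator corrects `1 - 1` to `1` on the diagonal. The shift between rows counted from `0` and from
`1` accounts for the extra `d`. -/
theorem sum_ite_row_sub_col : ∑ k, ∑ l, ((if rowOf ν k = rowOf ν l then (1 : ℤ) else 0)
    - (if colOf ν k = colOf ν l then 1 else 0) + (if k = l then 1 else 0)) = kappa ν + d := by
  simp only [Finset.sum_add_distrib, Finset.sum_sub_distrib]
  rw [sum_ite_row, sum_ite_col, kappa_eq]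
  have hd : (d : ℤ) = ∑ i : Fin (len ν), (rowLen ν i : ℤ) := by
    rw [← Nat.cast_sum, sum_rowLen]
  have : ∑ k : Fin d, ∑ l, (if k = l then (1 : ℤ) else 0) = d := by simp
  rw [this, Finset.sum_sub_distrib]
  have h2 : ∑ i : Fin (len ν), 2 * ((i : ℤ) + 1) * (rowLen ν i : ℤ) =
      2 * ∑ i : Fin (len ν), (i : ℤ) * (rowLen ν i : ℤ) + 2 * d := by
    rw [hd, Finset.mul_sum, Finset.mul_sum, ← Finset.sum_add_distrib]
    exact Finset.sum_congr rfl fun i _ => by ring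
  rw [h2]
  ring

end Boxes

/-! ### The central element `swapSum` acts on `specht ν` by a scalar. -/

section Symmetrizers

open Equiv MonoidAlgebra

variable {d : ℕ} (ν : Nat.Partition d)

theorem apply_swap_eq {α β : Type*} [DecidableEq α] (f : α → β) {k l : α} (h : f k = f l) (m : α) :
    f (swap k l m) = f m := by
  rw [swap_apply_def]
  split_ifs with h1 h2
  · rw [h1, h]
  · rw [h2, h]
  · rfl

theorem rowSymmetrizer_mul_swap {k l : Fin d} (h : rowOf ν k = rowOf ν l) :
    rowSymmetrizer ν * single (swap k l) 1 = rowSymmetrizer ν := by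
  unfold rowSymmetrizer
  rw [Finset.sum_mul]
  simp only [single_mul_single, mul_one]
  refine Finset.sum_bij (fun g _ => g * swap k l) ?_ ?_ ?_ ?_
  · intro g hg
    simp at hg ⊢
    intro m
    rw [hg, apply_swap_eq _ h]
  · intro g _ g' _ h
    exact mul_right_cancel h
  · intro g hg
    simp at hg
    refine ⟨g * swap k l, ?_, ?_⟩
    · simp
      intro m
      rw [hg, apply_swap_eq _ h]
    · simp [mul_assoc]
  · simp

theorem swap_mul_colAntisymmetrizer {k l : Fin d} (hkl : k ≠ l) (h : colOf ν k = colOf ν l) :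
    single (swap k l) 1 * colAntisymmetrizer ν = -colAntisymmetrizer ν := by
  unfold colAntisymmetrizer
  rw [Finset.mul_sum, ← Finset.sum_neg_distrib]
  simp only [single_mul_single, one_mul]
  refine Finset.sum_bij (fun g _ => swap k l * g) ?_ ?_ ?_ ?_
  · intro g hg
    simp at hg ⊢
    intro m
    rw [apply_swap_eq _ h, hg]
  · intro g _ g' _ h
    exact mul_left_cancel h
  · intro g hg
    simp at hg
    refine ⟨swap k l * g, ?_, ?_⟩
    · simp
      intro m
      rw [apply_swap_eq _ h, hg]
    · simp [← mul_assoc]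
  · intro g _
    rw [← MonoidAlgebra.single_neg]
    simp [Perm.sign_swap hkl]

/-- The box `m` is the corner in the row of `k` and the column of `l`. Since `(k m)(k l) = (k l)(l
m)`, the row symmetrizer absorbs `(k m)` while the column antisymmetrizer turns `(l m)` into a sign,
so the product equals its own negative. -/
theorem rowSymmetrizer_mul_swap_mul_colAntisymmetrizer_eq_zero {k l m : Fin d}
    (hr : rowOf ν k ≠ rowOf ν l) (hc : colOf ν k ≠ colOf ν l)
    (hmr : rowOf ν m = rowOf ν k) (hmc : colOf ν m = colOf ν l) :
    rowSymmetrizer ν * single (swap k l) 1 * colAntisymmetrizer ν = 0 := by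
  have hmk : m ≠ k := by rintro rfl; exact hc hmc
  have hml : m ≠ l := by rintro rfl; exact hr hmr.symm
  have key : swap k m * swap k l = swap k l * swap l m := by
    rw [mul_swap_eq_swap_mul (swap k l) l m, swap_apply_right, swap_apply_of_ne_of_ne hmk hml]
  have h : rowSymmetrizer ν * single (swap k l) 1 * colAntisymmetrizer ν =
      -(rowSymmetrizer ν * single (swap k l) 1 * colAntisymmetrizer ν) := by
    conv_lhs => rw [← rowSymmetrizer_mul_swap ν hmr.symm, mul_assoc (rowSymmetrizer ν),
      single_mul_single, key, ← single_mul_single, ← mul_assoc, mul_assoc _ _ (colAntisymmetrizer ν),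
      swap_mul_colAntisymmetrizer ν hml.symm hmc.symm, mul_neg]
  rw [eq_neg_iff_add_eq_zero, ← two_smul ℂ] at h
  exact (smul_eq_zero.mp h).resolve_left two_ne_zero

theorem rowSymmetrizer_mul_swap_mul_colAntisymmetrizer (k l : Fin d) :
    rowSymmetrizer ν * single (swap k l) 1 * colAntisymmetrizer ν =
      ((if rowOf ν k = rowOf ν l then (1 : ℤ) else 0)
        - (if colOf ν k = colOf ν l then 1 else 0) + (if k = l then 1 else 0)) •
      (rowSymmetrizer ν * colAntisymmetrizer ν) := by
  by_cases hkl : k = l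
  · subst hkl
    rw [swap_self]
    have : single (Equiv.refl (Fin d)) (1 : ℂ) = 1 := rfl
    simp [this]
  by_cases hr : rowOf ν k = rowOf ν l
  · have hc : colOf ν k ≠ colOf ν l := fun hc => hkl (box_ext ν hr hc)
    simp [rowSymmetrizer_mul_swap ν hr, hr, hc, hkl]
  by_cases hc : colOf ν k = colOf ν l
  · rw [mul_assoc, swap_mul_colAntisymmetrizer ν hkl hc]
    simp [hr, hc, hkl]
  · simp only [hr, hc, hkl, if_false, sub_zero, add_zero, zero_smul]
    -- Only the corner in the upper of the two rows is sure to lie in the diagram; the other case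
    -- exchanges `k` and `l`.
    rcases Nat.lt_or_gt_of_ne hr with h | h
    · obtain ⟨m, hm, hm'⟩ := exists_box ν h.le
      exact rowSymmetrizer_mul_swap_mul_colAntisymmetrizer_eq_zero ν hr hc hm hm'
    · obtain ⟨m, hm, hm'⟩ := exists_box ν h.le
      rw [swap_comm]
      exact rowSymmetrizer_mul_swap_mul_colAntisymmetrizer_eq_zero ν (Ne.symm hr) (Ne.symm hc) hm hm'

/-- The sum of all `swap k l`, over ordered pairs, `k = l` included. -/
def swapSum (d : ℕ) : MonoidAlgebra ℂ (Perm (Fin d)) := ∑ k, ∑ l, single (swap k l) 1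

/-- Conjugation by `g` sends `swap k l` to `swap (g k) (g l)`, which only reindexes the sum. -/
theorem single_mul_swapSum (g : Perm (Fin d)) (c : ℂ) :
    single g c * swapSum d = swapSum d * single g c := by
  unfold swapSum
  simp only [Finset.mul_sum, Finset.sum_mul, single_mul_single, mul_one, one_mul]
  rw [← Equiv.sum_comp g (fun k => ∑ l, single (swap k l * g) c)]
  refine Finset.sum_congr rfl fun k _ => ?_
  rw [← Equiv.sum_comp g (fun l => single (swap (g k) l * g) c)]
  refine Finset.sum_congr rfl fun l _ => ?_
  rw [mul_swap_eq_swap_mul]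

theorem mul_swapSum (x : MonoidAlgebra ℂ (Perm (Fin d))) : x * swapSum d = swapSum d * x := by
  induction x using MonoidAlgebra.induction_linear with
  | zero => simp
  | add x y hx hy => rw [add_mul, mul_add, hx, hy]
  | single g c => exact single_mul_swapSum g c

theorem swapSum_mul_of_mem_specht {x : MonoidAlgebra ℂ (Perm (Fin d))} (hx : x ∈ specht ν) :
    swapSum d * x = ((kappa ν : ℂ) + d) • x := by
  obtain ⟨y, rfl⟩ := Ideal.mem_span_singleton'.mp hx
  rw [← mul_assoc, ← mul_swapSum, mul_assoc, ← mul_assoc (swapSum d), ← mul_swapSum]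
  have : rowSymmetrizer ν * swapSum d * colAntisymmetrizer ν =
      ((kappa ν : ℂ) + d) • (rowSymmetrizer ν * colAntisymmetrizer ν) := by
    unfold swapSum
    simp only [Finset.mul_sum, Finset.sum_mul, rowSymmetrizer_mul_swap_mul_colAntisymmetrizer,
      ← Finset.sum_smul]
    rw [sum_ite_row_sub_col, ← Int.cast_smul_eq_zsmul ℂ]
    simp
  rw [this, mul_smul_comm]

end Symmetrizers

/-! ### The eigenvalue identity for characters. -/

section Characters

open Equiv

variable {d : ℕ} (ν : Nat.Partition d)

/-- The character of `specht ν`. -/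
def spechtChar (g : Perm (Fin d)) : ℂ := LinearMap.trace ℂ (specht ν) (spechtRep ν g)

theorem sum_spechtRep_swap :
    ∑ k, ∑ l, spechtRep ν (swap k l) = ((kappa ν : ℂ) + d) • LinearMap.id := by
  refine LinearMap.ext fun x => Subtype.ext ?_
  have := swapSum_mul_of_mem_specht ν x.2
  unfold swapSum at this
  simp only [Finset.sum_mul] at this
  simpa [spechtRep, LinearMap.sum_apply] using this

theorem sum_spechtChar_swap_mul (g : Perm (Fin d)) :
    ∑ k, ∑ l, spechtChar ν (swap k l * g) = ((kappa ν : ℂ) + d) * spechtChar ν g := by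
  unfold spechtChar
  simp only [map_mul, ← map_sum, ← Finset.sum_mul]
  rw [sum_spechtRep_swap]
  simp [← Module.End.one_eq_id]

theorem spechtChar_eq_of_isConj {g h : Perm (Fin d)} (H : IsConj g h) :
    spechtChar ν g = spechtChar ν h := by
  obtain ⟨c, rfl⟩ := isConj_iff.mp H
  unfold spechtChar
  rw [map_mul, LinearMap.trace_mul_comm, ← map_mul]
  simp

theorem chi_eq {μ : Nat.Partition d} {g : Perm (Fin d)} (h : g.partition.parts = μ.parts) :
    chi ν μ = spechtChar ν g := by
  refine spechtChar_eq_of_isConj ν (Perm.partition_eq_of_isConj.mpr ?_)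
  ext1
  rw [h]
  exact (exists_perm_parts μ).choose_spec

end Characters

/-! ### How multiplication by a transposition changes the cycle type. -/

section CycleTypes

open Equiv Equiv.Perm

variable {α : Type*} [DecidableEq α]

/-- Used in both directions: it joins two disjoint cycles, and, multiplied by `swap x y` once more,
cuts one cycle. -/
theorem formPerm_append (x y : α) (s t : List α) (h : (x :: s ++ y :: t).Nodup) :
    (x :: s ++ y :: t).formPerm = swap x y * (x :: s).formPerm * (y :: t).formPerm := by
  induction s generalizing x with
  | nil => simp
  | cons z s ih =>
    have h' : (z :: s ++ y :: t).Nodup := (List.nodup_cons.mp h).2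
    have hxy : x ≠ y := by rintro rfl; simp at h
    have hxz : x ≠ z := by rintro rfl; simp at h
    have hzy : z ≠ y := by rintro rfl; simp at h'
    have key : swap x z * swap z y = swap x y * swap x z := by
      rw [mul_swap_eq_swap_mul (swap x z) z y, swap_apply_right,
        swap_apply_of_ne_of_ne hxy.symm hzy.symm]
    change (x :: z :: (s ++ y :: t)).formPerm = _
    rw [List.formPerm_cons_cons, List.formPerm_cons_cons]
    change swap x z * (z :: s ++ y :: t).formPerm = _
    rw [ih z h', ← mul_assoc, ← mul_assoc, key]
    simp only [mul_assoc]

variable [Fintype α]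

/-- The entries of `l` are fixed points of `h`, and the new cycle replaces that many parts `1`. The
additive form avoids truncated subtraction of multisets. -/
theorem parts_formPerm_mul {l : List α} (hl : l.Nodup) (hne : l ≠ []) {h : Perm α}
    (hh : ∀ x ∈ l, h x = x) :
    (l.formPerm * h).partition.parts + Multiset.replicate l.length 1 =
      h.partition.parts + {l.length} := by
  rcases Nat.lt_or_ge l.length 2 with h1 | h2
  · have : l.length = 1 := by
      have := List.length_pos_iff.mpr hne
      omega
    obtain ⟨x, rfl⟩ := List.length_eq_one_iff.mp this
    simp
  · have hs : l.formPerm.support = l.toFinset := List.support_formPerm_of_nodup l hl (by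
      rintro x rfl
      simp at h2)
    have hd : Perm.Disjoint l.formPerm h := by
      intro x
      by_cases hx : x ∈ l
      · exact Or.inr (hh x hx)
      · exact Or.inl (List.formPerm_apply_of_notMem hx)
    have hc : l.formPerm.support.card = l.length := by
      rw [hs, List.toFinset_card_of_nodup hl]
    have hle : (l.formPerm * h).support.card ≤ Fintype.card α := Finset.card_le_univ _
    rw [parts_partition, parts_partition, hd.cycleType_mul, hd.card_support_mul, hc,
      (List.isCycle_formPerm hl h2).cycleType, hc]
    rw [hd.card_support_mul, hc] at hle
    have : Fintype.card α - h.support.card =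
        Fintype.card α - (l.length + h.support.card) + l.length := by omega
    rw [this, Multiset.replicate_add]
    abel

theorem parts_formPerm_append {s t : List α} (hst : (s ++ t).Nodup) (hs : s ≠ []) (ht : t ≠ [])
    {h : Perm α} (hh : ∀ x ∈ s ++ t, h x = x) :
    ((s ++ t).formPerm * h).partition.parts + {s.length} + {t.length} =
      (s.formPerm * t.formPerm * h).partition.parts + {s.length + t.length} := by
  have h1 := parts_formPerm_mul hst (by simp [hs]) hh
  have h2 := parts_formPerm_mul (List.nodup_append.mp hst).2.1 ht
    (fun x hx => hh x (List.mem_append_right s hx))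
  have h3 := parts_formPerm_mul (h := t.formPerm * h) (List.nodup_append.mp hst).1 hs
    (fun x hx => by
      rw [Perm.mul_apply, hh x (List.mem_append_left t hx)]
      exact List.formPerm_apply_of_notMem fun hx' =>
        (List.nodup_append.mp hst).2.2 x hx x hx' rfl)
  rw [← mul_assoc] at h3
  rw [List.length_append, Multiset.replicate_add] at h1
  apply add_right_cancel (b := Multiset.replicate s.length 1 + Multiset.replicate t.length 1)
  calc _ = ((s ++ t).formPerm * h).partition.parts +
        (Multiset.replicate s.length 1 + Multiset.replicate t.length 1) +
        {s.length} + {t.length} := by abel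
    _ = h.partition.parts + {t.length} + {s.length} + {s.length + t.length} := by rw [h1]; abel
    _ = _ := by 
      rw [← h2, add_right_comm _ (Multiset.replicate t.length 1), ← h3]
      abel

/-- The cycle of `g` through `x`, as a list that begins with `x`. -/
def orbitList (g : Perm α) (x : α) : List α := if g x = x then [x] else g.toList x

variable (g : Perm α)

theorem mem_orbitList {x y : α} : y ∈ orbitList g x ↔ g.SameCycle x y := by
  unfold orbitList
  split_ifs with h
  · rw [List.mem_singleton]
    exact ⟨fun h' => h' ▸ SameCycle.refl g y, fun h' => (h'.eq_of_left h).symm⟩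
  · rw [mem_toList_iff, mem_support]
    simp [h]

theorem nodup_orbitList (x : α) : (orbitList g x).Nodup := by
  unfold orbitList
  split_ifs
  · simp
  · exact nodup_toList g x

theorem orbitList_ne_nil (x : α) : orbitList g x ≠ [] :=
  List.ne_nil_of_mem ((mem_orbitList g).mpr (SameCycle.refl g x))

theorem orbitList_length_pos (x : α) : 0 < (orbitList g x).length :=
  List.length_pos_iff.mpr (orbitList_ne_nil g x)

theorem exists_orbitList_eq_cons (x : α) : ∃ s, orbitList g x = x :: s := by
  unfold orbitList
  split_ifs with h
  · exact ⟨[], rfl⟩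
  · have h0 := toList_getElem_zero g x (mem_support.mpr h)
    have hpos := length_toList_pos_of_mem_support g x (mem_support.mpr h)
    rcases hl : g.toList x with _ | ⟨z, l⟩
    · simp [hl] at hpos
    · exact ⟨l, by simpa [hl] using h0⟩

theorem formPerm_orbitList (x : α) : (orbitList g x).formPerm = g.cycleOf x := by
  unfold orbitList
  split_ifs with h
  · rw [List.formPerm_singleton, (cycleOf_eq_one_iff g).mpr h]
  · exact formPerm_toList g x

theorem orbitList_length_eq {x y : α} (h : g.SameCycle x y) :
    (orbitList g x).length = (orbitList g y).length := by
  rw [← List.toFinset_card_of_nodup (nodup_orbitList g x),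
    ← List.toFinset_card_of_nodup (nodup_orbitList g y)]
  congr 1
  ext z
  simp only [List.mem_toFinset, mem_orbitList]
  exact ⟨h.symm.trans, h.trans⟩

theorem orbitList_length_le (x : α) : (orbitList g x).length ≤ Fintype.card α :=
  (nodup_orbitList g x).length_le_card

theorem parts_swap_mul_of_not_sameCycle {x y : α} (h : ¬ g.SameCycle x y) :
    (swap x y * g).partition.parts + {(orbitList g x).length} + {(orbitList g y).length} =
      g.partition.parts + {(orbitList g x).length + (orbitList g y).length} := by
  have hnd : (orbitList g x ++ orbitList g y).Nodup := by
    refine List.nodup_append.mpr ⟨nodup_orbitList g x, nodup_orbitList g y, ?_⟩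
    rintro z hz _ hz' rfl
    rw [mem_orbitList] at hz hz'
    exact h (hz.trans hz'.symm)
  obtain ⟨s, hs⟩ := exists_orbitList_eq_cons g x
  obtain ⟨t, ht⟩ := exists_orbitList_eq_cons g y
  have hx : (x :: s).formPerm = g.cycleOf x := by rw [← hs, formPerm_orbitList]
  have hy : (y :: t).formPerm = g.cycleOf y := by rw [← ht, formPerm_orbitList]
  have := parts_formPerm_append hnd (orbitList_ne_nil g x) (orbitList_ne_nil g y)
    -- This is `g` with both cycles removed, so it fixes all their points.
    (h := (g.cycleOf y)⁻¹ * (g.cycleOf x)⁻¹ * g) (by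
      intro z hz
      rw [Perm.mul_apply, Perm.mul_apply, Perm.inv_eq_iff_eq, Perm.inv_eq_iff_eq]
      rw [List.mem_append, mem_orbitList, mem_orbitList] at hz
      rcases hz with hz | hz
      · have : ¬ g.SameCycle y z := fun h' => h (hz.trans h'.symm)
        rw [cycleOf_apply_of_not_sameCycle this, hz.cycleOf_apply]
      · have : ¬ g.SameCycle x (g z) := fun h' =>
          h ((sameCycle_apply_right.mp h').trans hz.symm)
        rw [hz.cycleOf_apply, cycleOf_apply_of_not_sameCycle this])
  rw [formPerm_orbitList, formPerm_orbitList] at this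
  rw [hs, ht] at this hnd ⊢
  rw [formPerm_append _ _ _ _ hnd, hx, hy] at this
  simpa [mul_assoc] using this

/-- Splitting the list of the cycle before position `a` exhibits it as a join of two shorter cycles
by this very transposition, which therefore cancels. -/
theorem parts_swap_mul_of_sameCycle {x : α} {a : ℕ} (ha : 0 < a)
    (ha' : a < (orbitList g x).length) :
    (swap x (orbitList g x)[a] * g).partition.parts + {(orbitList g x).length} =
      g.partition.parts + {a} + {(orbitList g x).length - a} := by
  have hnd := nodup_orbitList g x
  obtain ⟨u, h0⟩ := exists_orbitList_eq_cons g x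
  have hh : ∀ z ∈ orbitList g x, ((g.cycleOf x)⁻¹ * g) z = z := by
    intro z hz
    rw [Perm.mul_apply, Perm.inv_eq_iff_eq]
    rw [mem_orbitList] at hz
    rw [hz.cycleOf_apply]
  have hf := formPerm_orbitList g x
  generalize orbitList g x = l at ha' h0 hnd hh hf ⊢
  have hsplit : l = l.take a ++ l.drop a := (List.take_append_drop a l).symm
  obtain ⟨s, hs⟩ : ∃ s, l.take a = x :: s := by
    exact ⟨u.take (a - 1), by conv_lhs => rw [h0, List.take_cons ha]⟩
  have ht : l.drop a = l[a] :: l.drop (a + 1) := List.drop_eq_getElem_cons ha'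
  have hls : (l.take a).length = a := by rw [List.length_take]; omega
  have hlt : (l.drop a).length = l.length - a := List.length_drop
  rw [hsplit] at hnd hh hf
  have := parts_formPerm_append hnd (by rw [hs]; exact List.cons_ne_nil _ _)
    (by rw [ht]; exact List.cons_ne_nil _ _) hh
  rw [hls, hlt, hf, mul_inv_cancel_left, show a + (l.length - a) = l.length by omega] at this
  rw [this]
  have e : (l.take a).formPerm * (l.drop a).formPerm = swap x l[a] * g.cycleOf x := by
    rw [← hf]
    rw [hs, ht] at hnd ⊢
    rw [formPerm_append _ _ _ _ hnd, ← mul_assoc, ← mul_assoc, swap_mul_self, one_mul]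
  rw [e, mul_assoc, mul_inv_cancel_left]

/-- Grouping points by cycle: each cycle of length `n` contains `n` points. -/
theorem sum_orbitList_length {M : Type*} [AddCommMonoid M] (f : ℕ → M) :
    ∑ x, f (orbitList g x).length = (g.partition.parts.map fun n => n • f n).sum := by
  rw [parts_partition, Multiset.map_add, Multiset.sum_add, ← Finset.sum_add_sum_compl g.support]
  congr 1
  · rw [cycleType_def, Multiset.map_map]
    change _ = ∑ c ∈ g.cycleFactorsFinset, _
    rw [← Finset.sum_fiberwise_of_maps_to (g := g.cycleOf)
      (fun x hx => cycleOf_mem_cycleFactorsFinset_iff.mpr hx)]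
    refine Finset.sum_congr rfl fun c hc => ?_
    have : {x ∈ g.support | g.cycleOf x = c} = c.support := by
      ext x
      rw [Finset.mem_filter]
      constructor
      · rintro ⟨hx, rfl⟩
        exact mem_support_cycleOf_iff.mpr ⟨SameCycle.refl g x, hx⟩
      · exact fun hx => ⟨mem_cycleFactorsFinset_support_le hc hx, (cycle_is_cycleOf hx hc).symm⟩
    rw [this]
    simp only [Function.comp_apply]
    rw [← Finset.sum_const]
    refine Finset.sum_congr rfl fun x hx => ?_
    rw [cycle_is_cycleOf hx hc]
    have hgx := mem_cycleFactorsFinset_support_le hc hx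
    rw [orbitList, if_neg (mem_support.mp hgx), length_toList]
  · rw [Multiset.map_replicate, Multiset.sum_replicate, one_smul, ← Finset.card_compl,
      ← Finset.sum_const]
    refine Finset.sum_congr rfl fun x hx => ?_
    rw [Finset.mem_compl, notMem_support] at hx
    rw [orbitList, if_pos hx, List.length_singleton]

theorem card_orbitList_length_eq (n : ℕ) :
    (Finset.univ.filter fun x => (orbitList g x).length = n).card =
      n * g.partition.parts.count n := by
  rw [Finset.card_filter, sum_orbitList_length g (fun k => if k = n then 1 else 0)]
  generalize g.partition.parts = s
  induction s using Multiset.induction with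
  | empty => simp
  | cons a s ih =>
    rw [Multiset.map_cons, Multiset.sum_cons, ih, Multiset.count_cons]
    by_cases h : a = n
    · subst h; simp; ring
    · simp [h, Ne.symm h]

end CycleTypes

/-! ### The cut-and-join sum over all pairs of points. -/

section CutJoin

open Equiv Equiv.Perm

variable {α : Type*} [DecidableEq α] [Fintype α] (g : Perm α)

theorem parts_swap_mul_join {x y : α} (h : ¬ g.SameCycle x y) :
    (swap x y * g).partition.parts =
      g.partition.parts - {(orbitList g x).length} - {(orbitList g y).length} +
        {(orbitList g x).length + (orbitList g y).length} := by
  have key := parts_swap_mul_of_not_sameCycle g h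
  have hx := orbitList_length_pos g x
  have hy := orbitList_length_pos g y
  ext n
  have := congrArg (Multiset.count n) key
  simp only [Multiset.count_add, Multiset.count_sub, Multiset.count_singleton] at this ⊢
  split_ifs at this ⊢ <;> omega

theorem parts_swap_mul_cut {x : α} {a : ℕ} (ha : 0 < a)
    (ha' : a < (orbitList g x).length) :
    (swap x (orbitList g x)[a] * g).partition.parts =
      g.partition.parts - {(orbitList g x).length} + {a} + {(orbitList g x).length - a} := by
  have key := parts_swap_mul_of_sameCycle g ha ha'
  ext n
  have := congrArg (Multiset.count n) key
  simp only [Multiset.count_add, Multiset.count_sub, Multiset.count_singleton] at this ⊢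
  split_ifs at this ⊢ <;> omega

variable {M : Type*} [AddCommMonoid M]

theorem sum_sameCycle (f : α → M) (x : α) :
    ∑ y with g.SameCycle x y, f y =
      ∑ a : Fin (orbitList g x).length, f (orbitList g x)[a] := by
  have : Finset.univ.filter (fun y => g.SameCycle x y) = (orbitList g x).toFinset := by
    ext y
    simp [mem_orbitList]
  rw [this, List.sum_toFinset _ (nodup_orbitList g x), ← List.sum_ofFn]
  congr 1
  apply List.ext_get <;> simp

/-- Position `0` of the cycle is `y = x` and leaves `g` unchanged; position `a > 0` cuts the cycle
into lengths `i = a` and `j`, the rest. -/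
theorem sum_sameCycle_swap_mul (F : Multiset ℕ → M) (x : α) {N : ℕ} (hN : Fintype.card α ≤ N) :
    ∑ y with g.SameCycle x y, F (swap x y * g).partition.parts =
      F g.partition.parts + ∑ i ∈ Finset.Icc 1 N, ∑ j ∈ Finset.Icc 1 N,
        if (orbitList g x).length = i + j then
          F (g.partition.parts - {i + j} + {i} + {j}) else 0 := by
  rw [sum_sameCycle g (fun y => F (swap x y * g).partition.parts)]
  have hpos := orbitList_length_pos g x
  have hle := (orbitList_length_le g x).trans hN
  have h0 (h : 0 < (orbitList g x).length) : (orbitList g x)[0] = x := by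
    obtain ⟨u, h0⟩ := exists_orbitList_eq_cons g x
    simp [h0]
  have h1 (a : ℕ) (ha : a < (orbitList g x).length) (ha0 : 0 < a) :=
    parts_swap_mul_cut g ha0 ha
  obtain ⟨n, hn⟩ : ∃ n, (orbitList g x).length = n + 1 := ⟨(orbitList g x).length - 1, by omega⟩
  have : ∑ a : Fin (orbitList g x).length, F (swap x (orbitList g x)[a] * g).partition.parts =
      ∑ a ∈ Finset.range (orbitList g x).length, if a = 0 then F g.partition.parts else
        F (g.partition.parts - {(orbitList g x).length} + {a} + {(orbitList g x).length - a}) := by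
    rw [Finset.sum_range]
    refine Finset.sum_congr rfl fun a _ => ?_
    split_ifs with h
    · have : (orbitList g x)[a] = x := by simp [h, h0 hpos]
      rw [this]
      simp [swap_self, ← Perm.one_def]
    · rw [← h1 a a.isLt (by omega)]
      rfl
  rw [this, hn, Finset.sum_range_succ', if_pos rfl, add_comm]
  congr 1
  rw [hn] at hle
  have h2 (i : ℕ) (hi : i ∈ Finset.Icc 1 N) : (∑ j ∈ Finset.Icc 1 N, if n + 1 = i + j then
      F (g.partition.parts - {i + j} + {i} + {j}) else 0) =
      if i ∈ Finset.Icc 1 n then F (g.partition.parts - {n + 1} + {i} + {n + 1 - i}) else 0 := by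
    rw [Finset.mem_Icc] at hi
    split_ifs with h <;> rw [Finset.mem_Icc] at h
    · rw [Finset.sum_eq_single (n + 1 - i)]
      · rw [if_pos (by omega), show i + (n + 1 - i) = n + 1 by omega]
      · intro j _ hj
        rw [if_neg (by omega)]
      · intro hj
        rw [Finset.mem_Icc] at hj
        omega
    · refine Finset.sum_eq_zero fun j hj => ?_
      rw [Finset.mem_Icc] at hj
      rw [if_neg (by omega)]
  rw [Finset.sum_congr rfl h2, ← Finset.sum_filter,
    show (Finset.Icc 1 N).filter (· ∈ Finset.Icc 1 n) = Finset.Icc 1 n by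
      ext i; simp only [Finset.mem_filter, Finset.mem_Icc]; omega]
  rw [Finset.range_eq_Ico, Finset.sum_Ico_add' (fun a => if a = 0 then F g.partition.parts else
        F (g.partition.parts - {n + 1} + {a} + {n + 1 - a})) 0 n 1]
  refine Finset.sum_congr (by ext; simp) fun a ha => ?_
  rw [if_neg (by rw [Finset.mem_Icc] at ha; omega)]

/-- There are `j` points for each cycle of length `j`, except the cycle of `x` itself; removing one
part before counting records this exception. -/
theorem card_not_sameCycle (x : α) (j : ℕ) :
    (Finset.univ.filter fun y => ¬ g.SameCycle x y ∧ (orbitList g y).length = j).card =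
      j * (g.partition.parts - {(orbitList g x).length}).count j := by
  have h := card_orbitList_length_eq g j
  rw [← Finset.card_filter_add_card_filter_not (p := fun y => g.SameCycle x y), Finset.filter_filter,
    Finset.filter_filter] at h
  have h1 : (Finset.univ.filter fun y => (orbitList g y).length = j ∧ g.SameCycle x y).card =
      if j = (orbitList g x).length then j else 0 := by
    split_ifs with hj
    · rw [hj, ← List.toFinset_card_of_nodup (nodup_orbitList g x)]
      congr 1
      ext y
      simp only [Finset.mem_filter, Finset.mem_univ, true_and, List.mem_toFinset, mem_orbitList]
      exact ⟨fun h => h.2, fun h => ⟨by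
        rw [List.toFinset_card_of_nodup (nodup_orbitList g x), orbitList_length_eq g h], h⟩⟩
    · rw [Finset.card_eq_zero, Finset.filter_eq_empty_iff]
      rintro y - ⟨hy, hxy⟩
      exact hj (by rw [← hy, orbitList_length_eq g hxy])
  rw [h1] at h
  simp only [and_comm (a := ¬ _)]
  rw [Multiset.count_sub, Multiset.count_singleton, Nat.mul_sub, ← h]
  split_ifs <;> simp

theorem sum_not_sameCycle_swap_mul (F : Multiset ℕ → M) {N : ℕ} (hN : Fintype.card α ≤ N) :
    ∑ x, ∑ y with ¬ g.SameCycle x y, F (swap x y * g).partition.parts =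
      ∑ i ∈ Finset.Icc 1 N, ∑ j ∈ Finset.Icc 1 N,
        (i * g.partition.parts.count i * (j * (g.partition.parts - {i}).count j)) •
          F (g.partition.parts - {i} - {j} + {i + j}) := by
  have hmem (x : α) : (orbitList g x).length ∈ Finset.Icc 1 N :=
    Finset.mem_Icc.mpr ⟨orbitList_length_pos g x, (orbitList_length_le g x).trans hN⟩
  have h1 (x : α) : ∑ y with ¬ g.SameCycle x y, F (swap x y * g).partition.parts =
      ∑ j ∈ Finset.Icc 1 N, (j * (g.partition.parts - {(orbitList g x).length}).count j) •
        F (g.partition.parts - {(orbitList g x).length} - {j} + {(orbitList g x).length + j}) := by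
    rw [← Finset.sum_fiberwise_of_maps_to (g := fun y => (orbitList g y).length)
      (fun y _ => hmem y)]
    refine Finset.sum_congr rfl fun j _ => ?_
    rw [Finset.filter_filter, ← card_not_sameCycle, ← Finset.sum_const]
    refine Finset.sum_congr rfl fun y hy => ?_
    simp only [Finset.mem_filter, Finset.mem_univ, true_and] at hy
    rw [parts_swap_mul_join g hy.1, hy.2]
  simp only [h1]
  rw [← Finset.sum_fiberwise_of_maps_to (g := fun x => (orbitList g x).length)
      (fun x _ => hmem x)]
  refine Finset.sum_congr rfl fun i _ => ?_
  rw [Finset.sum_congr rfl (g := fun _ => ∑ j ∈ Finset.Icc 1 N,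
    (j * (g.partition.parts - {i}).count j) • F (g.partition.parts - {i} - {j} + {i + j}))
    (fun x hx => by simp only [Finset.mem_filter, Finset.mem_univ, true_and] at hx; rw [hx]),
    Finset.sum_const, card_orbitList_length_eq, Finset.smul_sum]
  simp only [mul_smul]

theorem sum_swap_mul (F : Multiset ℕ → M) {N : ℕ} (hN : Fintype.card α ≤ N) :
    ∑ x, ∑ y, F (swap x y * g).partition.parts =
      Fintype.card α • F g.partition.parts +
      ∑ i ∈ Finset.Icc 1 N, ∑ j ∈ Finset.Icc 1 N,
        (((i + j) * g.partition.parts.count (i + j)) • F (g.partition.parts - {i + j} + {i} + {j}) +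
        (i * g.partition.parts.count i * (j * (g.partition.parts - {i}).count j)) •
          F (g.partition.parts - {i} - {j} + {i + j})) := by
  simp only [Finset.sum_add_distrib]
  rw [← sum_not_sameCycle_swap_mul g F hN, ← add_assoc]
  have h (x : α) := Finset.sum_filter_add_sum_filter_not Finset.univ (fun y => g.SameCycle x y)
    (fun y => F (swap x y * g).partition.parts)
  simp only [← h, Finset.sum_add_distrib]
  congr 1
  simp only [sum_sameCycle_swap_mul g F _ hN, Finset.sum_add_distrib]
  rw [Finset.sum_const, Finset.card_univ]
  congr 1
  rw [Finset.sum_comm]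
  refine Finset.sum_congr rfl fun i _ => ?_
  rw [Finset.sum_comm]
  refine Finset.sum_congr rfl fun j _ => ?_
  rw [← Finset.sum_filter, Finset.sum_const, card_orbitList_length_eq]

end CutJoin

/-! ### The derivation `∂/∂τ` on coefficients. -/

section TauDerivative

/-- Complex numbers as coefficients. -/
def scalar : ℂ →+* Coeff := (HahnSeries.C : ℂ[X] →+* Coeff).comp Polynomial.C

theorem smul_eq_scalar_mul (c : ℂ) (x : Coeff) : c • x = scalar c * x := by
  refine HahnSeries.ext (funext fun n => ?_)
  rw [scalar, RingHom.comp_apply, HahnSeries.C_mul_eq_smul, HahnSeries.coeff_smul,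
    HahnSeries.coeff_smul, smul_eq_mul, Polynomial.smul_eq_C_mul]

theorem dTau_coeff (x : Coeff) (n : ℤ) :
    (dTau x).coeff n = Polynomial.derivative (x.coeff n) := rfl

theorem dTau_add (x y : Coeff) : dTau (x + y) = dTau x + dTau y := by
  refine HahnSeries.ext (funext fun n => ?_)
  simp [dTau_coeff]

theorem dTau_zero : dTau 0 = 0 := by
  refine HahnSeries.ext (funext fun n => ?_)
  simp [dTau_coeff]

theorem dTau_sum {ι : Type*} (s : Finset ι) (f : ι → Coeff) :
    dTau (∑ i ∈ s, f i) = ∑ i ∈ s, dTau (f i) :=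
  map_sum (⟨⟨dTau, dTau_zero⟩, dTau_add⟩ : Coeff →+ Coeff) f s

theorem dTau_mul (x y : Coeff) : dTau (x * y) = x * dTau y + y * dTau x := by
  -- Differentiation can only shrink supports, so all three products can be summed over the index
  -- set of `x * y`.
  have hsub (z : Coeff) : (dTau z).support ⊆ z.support := by
    intro n hn hz
    exact hn (by simp only [dTau_coeff, hz, map_zero])
  refine HahnSeries.ext (funext fun n => ?_)
  rw [dTau_coeff, mul_comm y, HahnSeries.coeff_add, HahnSeries.coeff_mul,
    HahnSeries.coeff_mul_right' y.isPWO_support (hsub y),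
    HahnSeries.coeff_mul_left' x.isPWO_support (hsub x), map_sum, ← Finset.sum_add_distrib]
  refine Finset.sum_congr rfl fun ij _ => ?_
  rw [Polynomial.derivative_mul, dTau_coeff, dTau_coeff, add_comm]

theorem dTau_map_C (x : LaurentSeries ℂ) : dTau (HahnSeries.map x (Polynomial.C (R := ℂ))) = 0 := by
  refine HahnSeries.ext (funext fun n => ?_)
  simp [dTau_coeff]

theorem dTau_scalar (c : ℂ) : dTau (scalar c) = 0 := by
  refine HahnSeries.ext (funext fun n => ?_)
  rw [dTau_coeff, scalar, RingHom.comp_apply, HahnSeries.C_apply, HahnSeries.coeff_single]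
  split_ifs <;> simp

theorem dTau_ofPowerSeries (f : PowerSeries ℂ[X]) :
    dTau (HahnSeries.ofPowerSeries ℤ ℂ[X] f) = HahnSeries.ofPowerSeries ℤ ℂ[X]
      (PowerSeries.mk fun n => Polynomial.derivative (PowerSeries.coeff n f)) := by
  refine HahnSeries.ext (funext fun n => ?_)
  rw [dTau_coeff, PowerSeries.coeff_coe, PowerSeries.coeff_coe]
  split_ifs <;> simp

theorem dTau_expKappa {d : ℕ} (ν : Nat.Partition d) :
    dTau (expKappa ν) = scalar (Complex.I * (kappa ν : ℂ) / 2) * (lam * expKappa ν) := by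
  have hlam : lam = HahnSeries.ofPowerSeries ℤ ℂ[X] PowerSeries.X :=
    HahnSeries.ofPowerSeries_X.symm
  unfold expKappa
  generalize Complex.I * (kappa ν : ℂ) / 2 = c
  have hc : scalar c = HahnSeries.ofPowerSeries ℤ ℂ[X] (PowerSeries.C (Polynomial.C c)) :=
    (HahnSeries.ofPowerSeries_C _).symm
  rw [dTau_ofPowerSeries, hlam, hc, ← map_mul, ← map_mul]
  congr 1
  refine PowerSeries.ext fun n => ?_
  rw [PowerSeries.coeff_mk, PowerSeries.coeff_C_mul, PowerSeries.coeff_rescale]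
  cases n with
  | zero => simp
  | succ n =>
    -- The factor `n + 1` from differentiating the power lowers the factorial, as in the derivative
    -- of `exp`.
    have hfac : algebraMap ℚ ℂ[X] (1 / ((n + 1).factorial : ℚ)) * ((n + 1 : ℕ) : ℂ[X]) =
        algebraMap ℚ ℂ[X] (1 / (n.factorial : ℚ)) := by
      rw [← map_natCast (algebraMap ℚ ℂ[X]) (n + 1), ← map_mul]
      congr 1
      rw [Nat.factorial_succ]
      have := Nat.factorial_ne_zero n
      push_cast
      field_simp
    have hder : Polynomial.derivative (algebraMap ℚ ℂ[X] (1 / ((n + 1).factorial : ℚ))) = 0 := by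
      rw [IsScalarTower.algebraMap_apply ℚ ℂ ℂ[X]]
      exact Polynomial.derivative_C
    rw [PowerSeries.coeff_succ_X_mul, PowerSeries.coeff_rescale, PowerSeries.coeff_exp,
      PowerSeries.coeff_exp, Polynomial.derivative_mul, hder, ← hfac, Polynomial.derivative_pow]
    simp
    ring

end TauDerivative

/-! ### The recursion for the numerators of the weights. -/

section MultisetCharacters

open Equiv

variable {d : ℕ} (ν : Nat.Partition d)

/-- The character of `specht ν` at the permutations with cycle lengths `s`. -/
def multisetChar (s : Multiset ℕ) : ℂ :=
  open Classical in
  if h : ∃ g : Perm (Fin d), g.partition.parts = s then spechtChar ν h.choose else 0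

theorem multisetChar_parts (g : Perm (Fin d)) :
    multisetChar ν g.partition.parts = spechtChar ν g := by
  have h : ∃ g' : Perm (Fin d), g'.partition.parts = g.partition.parts := ⟨g, rfl⟩
  rw [multisetChar, dif_pos h]
  refine spechtChar_eq_of_isConj ν (Perm.partition_eq_of_isConj.mpr ?_)
  ext1
  exact h.choose_spec

theorem chi_eq_multisetChar (μ : Nat.Partition d) : chi ν μ = multisetChar ν μ.parts := by
  obtain ⟨g, hg⟩ := exists_perm_parts μ
  rw [chi_eq ν hg, ← hg, multisetChar_parts]

/-- The diagonal pairs contribute `d` times the character, which cancels the `d` in the eigenvalue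
`κ_ν + d`. -/
theorem kappa_mul_multisetChar (μ : Nat.Partition d) {N : ℕ} (hN : d ≤ N) :
    (kappa ν : ℂ) * multisetChar ν μ.parts =
      ∑ i ∈ Finset.Icc 1 N, ∑ j ∈ Finset.Icc 1 N,
        (((i + j) * μ.parts.count (i + j)) • multisetChar ν (μ.parts - {i + j} + {i} + {j}) +
        (i * μ.parts.count i * (j * (μ.parts - {i}).count j)) •
          multisetChar ν (μ.parts - {i} - {j} + {i + j})) := by
  obtain ⟨g, hg⟩ := exists_perm_parts μ
  have h := sum_swap_mul g (multisetChar ν) (N := N) (by simpa using hN)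
  simp only [multisetChar_parts, sum_spechtChar_swap_mul] at h
  rw [← hg, multisetChar_parts]
  rw [add_mul, add_comm, nsmul_eq_mul] at h
  simp only [Fintype.card_fin] at h
  exact add_left_cancel h

/-- The numerator of `weight`, as a function of the cycle lengths. -/
def weightNumerator (d : ℕ) (s : Multiset ℕ) : Coeff :=
  ∑ ν : Nat.Partition d,
    scalar (multisetChar ν s) * (expKappa ν * HahnSeries.map (V ν) (Polynomial.C (R := ℂ)))

/-- The size appears in the type of a partition, and the sizes before and after a cut or a join are
only propositionally equal. A numerator that takes a multiset makes them comparable. -/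
theorem weight_eq {d' : ℕ} (μ : Nat.Partition d') (h : d' = d) :
    weight μ = scalar (zee μ : ℂ)⁻¹ * weightNumerator d μ.parts := by
  subst h
  unfold weight weightNumerator
  rw [Finset.mul_sum]
  refine Finset.sum_congr rfl fun ν _ => ?_
  rw [chi_eq_multisetChar, smul_eq_scalar_mul, div_eq_inv_mul, map_mul, mul_assoc]

theorem halfILam_eq : halfILam = scalar (Complex.I / 2) * lam := smul_eq_scalar_mul _ _

theorem dTau_weightNumerator (μ : Nat.Partition d) {N : ℕ} (hN : d ≤ N) :
    dTau (weightNumerator d μ.parts) = halfILam *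
      ∑ i ∈ Finset.Icc 1 N, ∑ j ∈ Finset.Icc 1 N,
        (((i + j) * μ.parts.count (i + j)) • weightNumerator d (μ.parts - {i + j} + {i} + {j}) +
        (i * μ.parts.count i * (j * (μ.parts - {i}).count j)) •
          weightNumerator d (μ.parts - {i} - {j} + {i + j})) := by
  have h : ∑ i ∈ Finset.Icc 1 N, ∑ j ∈ Finset.Icc 1 N,
        (((i + j) * μ.parts.count (i + j)) • weightNumerator d (μ.parts - {i + j} + {i} + {j}) +
        (i * μ.parts.count i * (j * (μ.parts - {i}).count j)) •
          weightNumerator d (μ.parts - {i} - {j} + {i + j})) =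
      ∑ ν : Nat.Partition d, scalar ((kappa ν : ℂ) * multisetChar ν μ.parts) *
        (expKappa ν * HahnSeries.map (V ν) (Polynomial.C (R := ℂ))) := by
    simp only [kappa_mul_multisetChar _ μ hN, map_sum, map_add, map_nsmul, Finset.sum_mul, add_mul]
    refine Eq.trans ?_ Finset.sum_comm
    refine Finset.sum_congr rfl fun i _ => ?_
    refine Eq.trans ?_ Finset.sum_comm
    refine Finset.sum_congr rfl fun j _ => ?_
    rw [Finset.sum_add_distrib]
    unfold weightNumerator
    simp only [Finset.smul_sum, smul_mul_assoc]
  rw [h, halfILam_eq, weightNumerator, dTau_sum, Finset.mul_sum]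
  refine Finset.sum_congr rfl fun ν _ => ?_
  rw [dTau_mul, dTau_scalar, dTau_mul, dTau_map_C, dTau_expKappa, map_mul,
    mul_div_right_comm, map_mul]
  ring

end MultisetCharacters

/-! ### Partitions by multiplicities, and the behaviour of `z_μ`. -/

section Multiplicities

theorem parts_partitionOf_add (m n : ℕ+ →₀ ℕ) :
    (partitionOf (m + n)).parts = (partitionOf m).parts + (partitionOf n).parts := by
  simp [partitionOf]

theorem parts_partitionOf_single (i : ℕ+) :
    (partitionOf (Finsupp.single i 1)).parts = {(i : ℕ)} := by
  simp [partitionOf]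

theorem count_parts_partitionOf (m : ℕ+ →₀ ℕ) (i : ℕ+) :
    (partitionOf m).parts.count (i : ℕ) = m i := by
  classical
  unfold partitionOf
  rw [Multiset.count_map_eq_count' _ _ PNat.coe_injective, Finsupp.count_toMultiset]

/-- The size of the partition with multiplicities `m`. -/
def size (m : ℕ+ →₀ ℕ) : ℕ := ((Finsupp.toMultiset m).map (fun i : ℕ+ => (i : ℕ))).sum

theorem size_add (m n : ℕ+ →₀ ℕ) : size (m + n) = size m + size n := by
  simp [size]

theorem size_single (i : ℕ+) : size (Finsupp.single i 1) = i := by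
  simp [size]

theorem size_mono {m n : ℕ+ →₀ ℕ} (h : m ≤ n) : size m ≤ size n := by
  obtain ⟨k, rfl⟩ := le_iff_exists_add.mp h
  rw [size_add]
  omega

theorem zee_partitionOf (m : ℕ+ →₀ ℕ) {s : Finset ℕ+} (hs : m.support ⊆ s) :
    zee (partitionOf m) = ∏ i ∈ s, (m i).factorial * (i : ℕ) ^ (m i) := by
  classical
  have h : (partitionOf m).parts.toFinset = m.support.map ⟨_, PNat.coe_injective⟩ := by
    ext k
    simp [partitionOf]
  rw [zee, h, Finset.prod_map]
  simp only [Function.Embedding.coeFn_mk, count_parts_partitionOf]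
  refine Finset.prod_subset hs fun i _ hi => ?_
  rw [Finsupp.notMem_support_iff.mp hi]
  simp

theorem zee_partitionOf_add_single (m : ℕ+ →₀ ℕ) (i : ℕ+) :
    zee (partitionOf (m + Finsupp.single i 1)) = zee (partitionOf m) * ((m i + 1) * i) := by
  classical
  have h1 : m.support ⊆ insert i m.support := Finset.subset_insert _ _
  have h2 : (m + Finsupp.single i 1).support ⊆ insert i m.support := by
    intro k hk
    simp only [Finsupp.mem_support_iff, Finsupp.add_apply, Finset.mem_insert] at hk ⊢
    by_contra! h
    rw [h.2, Finsupp.single_eq_of_ne h.1] at hk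
    exact hk rfl
  rw [zee_partitionOf _ h1, zee_partitionOf _ h2,
    ← Finset.mul_prod_erase _ _ (Finset.mem_insert_self i _),
    ← Finset.mul_prod_erase _ _ (Finset.mem_insert_self i m.support)]
  have : ∏ k ∈ (insert i m.support).erase i,
      ((m + Finsupp.single i 1 : ℕ+ →₀ ℕ) k).factorial *
        (k : ℕ) ^ ((m + Finsupp.single i 1 : ℕ+ →₀ ℕ) k) =
      ∏ k ∈ (insert i m.support).erase i, (m k).factorial * (k : ℕ) ^ (m k) := by
    refine Finset.prod_congr rfl fun k hk => ?_
    rw [Finsupp.add_apply, Finsupp.single_eq_of_ne (Finset.ne_of_mem_erase hk), add_zero]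
  rw [this, Finsupp.add_apply, Finsupp.single_eq_same, Nat.factorial_succ, pow_succ]
  ring

theorem zee_partitionOf_ne_zero (m : ℕ+ →₀ ℕ) : zee (partitionOf m) ≠ 0 := by
  rw [zee_partitionOf m subset_rfl]
  refine Finset.prod_ne_zero_iff.mpr fun i _ => ?_
  have := i.pos
  positivity

end Multiplicities

/-! ### Coefficients of the cut and join terms of `RBullet`. -/

section Coefficients

theorem coeff_p_mul_add (n : ℕ+ →₀ ℕ) (k : ℕ+) (F : PSeries) :
    MvPowerSeries.coeff (n + Finsupp.single k 1) (p k * F) = MvPowerSeries.coeff n F := by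
  rw [add_comm, p, MvPowerSeries.X_def, MvPowerSeries.coeff_add_monomial_mul, one_mul]

theorem coeff_p_mul_eq_zero {m : ℕ+ →₀ ℕ} {k : ℕ+} (h : m k = 0) (F : PSeries) :
    MvPowerSeries.coeff m (p k * F) = 0 := by
  rw [p, MvPowerSeries.X_def, MvPowerSeries.coeff_monomial_mul, if_neg]
  intro hle
  have := hle k
  simp [h] at this

theorem exists_eq_add_single {m : ℕ+ →₀ ℕ} {k : ℕ+} (h : m k ≠ 0) :
    ∃ n, m = n + Finsupp.single k 1 := by
  refine ⟨m - Finsupp.single k 1, (tsub_add_cancel_of_le ?_).symm⟩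
  rw [Finsupp.single_le_iff]
  omega

theorem coeff_dP (n : ℕ+ →₀ ℕ) (i : ℕ+) (F : PSeries) :
    MvPowerSeries.coeff n (dP i F) =
      MvPowerSeries.coeff (n + Finsupp.single i 1) F * ((n i : Coeff) + 1) :=
  MvPowerSeries.coeff_pderiv F n

theorem coeff_RBullet (m : ℕ+ →₀ ℕ) :
    MvPowerSeries.coeff m RBullet = weight (partitionOf m) := rfl

theorem weight_partitionOf {m : ℕ+ →₀ ℕ} {d : ℕ} (h : size m = d) :
    weight (partitionOf m) =
      scalar (zee (partitionOf m) : ℂ)⁻¹ * weightNumerator d (partitionOf m).parts :=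
  weight_eq (partitionOf m) h

theorem coeff_natCast_mul (k : ℕ) (m : ℕ+ →₀ ℕ) (F : PSeries) :
    MvPowerSeries.coeff m ((k : PSeries) * F) = k * MvPowerSeries.coeff m F := by
  rw [← nsmul_eq_mul, map_nsmul, nsmul_eq_mul]

theorem scalar_natCast_inv_mul {a b c : ℕ} (h : a * b = c) (ha : a ≠ 0) (hb : b ≠ 0) :
    (b : Coeff) * scalar (c : ℂ)⁻¹ = scalar (a : ℂ)⁻¹ := by
  rw [← map_natCast scalar b, ← map_mul, ← h]
  congr 1
  push_cast
  have : (a : ℂ) ≠ 0 := by exact_mod_cast ha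
  have : (b : ℂ) ≠ 0 := by exact_mod_cast hb
  field_simp

/-- Remove one part `i + j` from `m`, leaving `n`. The multiplicities produced by the derivatives,
together with `i j`, are exactly the quotient of the `z` of `n` with parts `i`, `j` added by the `z`
of `n`. -/
theorem coeff_cut_RBullet (m : ℕ+ →₀ ℕ) (i j : ℕ+) :
    MvPowerSeries.coeff m (((i : ℕ) * (j : ℕ) : PSeries) * p (i + j) * dP i (dP j RBullet)) =
      scalar (zee (partitionOf m) : ℂ)⁻¹ *
        (((i : ℕ) + j) * (partitionOf m).parts.count ((i : ℕ) + j)) •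
          weightNumerator (size m) ((partitionOf m).parts - {(i : ℕ) + j} + {(i : ℕ)} + {(j : ℕ)}) := by
  rw [← Nat.cast_mul, mul_assoc, coeff_natCast_mul, ← PNat.add_coe, count_parts_partitionOf]
  by_cases h : m (i + j) = 0
  · rw [coeff_p_mul_eq_zero h, h]
    simp
  obtain ⟨n, rfl⟩ := exists_eq_add_single h
  have hsize : size (n + Finsupp.single i 1 + Finsupp.single j 1) =
      size (n + Finsupp.single (i + j) 1) := by
    simp only [size_add, size_single, PNat.add_coe]
    ring
  have hparts : (partitionOf (n + Finsupp.single i 1 + Finsupp.single j 1)).parts =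
      (partitionOf (n + Finsupp.single (i + j) 1)).parts - {((i + j : ℕ+) : ℕ)} + {(i : ℕ)} +
        {(j : ℕ)} := by
    simp only [parts_partitionOf_add, parts_partitionOf_single, Multiset.add_sub_cancel_right]
  rw [coeff_p_mul_add, coeff_dP, coeff_dP, coeff_RBullet, weight_partitionOf hsize, ← hparts]
  generalize weightNumerator _ _ = K
  have h1 := zee_partitionOf_add_single (n + Finsupp.single i 1) j
  rw [zee_partitionOf_add_single n i, mul_assoc] at h1
  have h2 := zee_partitionOf_add_single n (i + j)
  have hz := zee_partitionOf_ne_zero n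
  have hi := i.ne_zero
  have hj := j.ne_zero
  have e1 := scalar_natCast_inv_mul h1.symm hz (by positivity)
  have e2 := scalar_natCast_inv_mul h2.symm hz (by have := (i + j).ne_zero; positivity)
  rw [nsmul_eq_mul]
  have hs : (n + Finsupp.single (i + j) 1 : ℕ+ →₀ ℕ) (i + j) = n (i + j) + 1 := by simp
  rw [hs]
  push_cast at e1 e2 ⊢
  -- Both sides equal `K` divided by `zee (partitionOf n)`.
  linear_combination K * e1 - K * e2

theorem coeff_join_RBullet (m : ℕ+ →₀ ℕ) (i j : ℕ+) :
    MvPowerSeries.coeff m (((i : ℕ) + (j : ℕ) : PSeries) * p i * p j * dP (i + j) RBullet) =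
      scalar (zee (partitionOf m) : ℂ)⁻¹ *
        ((i : ℕ) * (partitionOf m).parts.count (i : ℕ) *
          ((j : ℕ) * ((partitionOf m).parts - {(i : ℕ)}).count (j : ℕ))) •
          weightNumerator (size m) ((partitionOf m).parts - {(i : ℕ)} - {(j : ℕ)} + {(i : ℕ) + j}) := by
  rw [← Nat.cast_add, mul_assoc, mul_assoc, coeff_natCast_mul, ← PNat.add_coe,
    count_parts_partitionOf]
  by_cases h : m i = 0
  · rw [coeff_p_mul_eq_zero h, h]
    simp
  obtain ⟨n', rfl⟩ := exists_eq_add_single h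
  have hsub : (partitionOf (n' + Finsupp.single i 1)).parts - {(i : ℕ)} = (partitionOf n').parts := by
    simp only [parts_partitionOf_add, parts_partitionOf_single, Multiset.add_sub_cancel_right]
  rw [coeff_p_mul_add, hsub, count_parts_partitionOf]
  -- Removing `i` first and then testing `j` also treats `i = j`, where two copies of the part are
  -- needed.
  by_cases h' : n' j = 0
  · rw [coeff_p_mul_eq_zero h', h']
    simp
  obtain ⟨n, rfl⟩ := exists_eq_add_single h'
  have hsize : size (n + Finsupp.single (i + j) 1) =
      size (n + Finsupp.single j 1 + Finsupp.single i 1) := by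
    simp only [size_add, size_single, PNat.add_coe]
    ring
  have hparts : (partitionOf (n + Finsupp.single (i + j) 1)).parts =
      (partitionOf (n + Finsupp.single j 1)).parts - {(j : ℕ)} + {((i + j : ℕ+) : ℕ)} := by
    simp only [parts_partitionOf_add, parts_partitionOf_single, Multiset.add_sub_cancel_right]
  rw [coeff_p_mul_add, coeff_dP, coeff_RBullet, weight_partitionOf hsize, ← hparts]
  generalize weightNumerator _ _ = K
  have h1 := zee_partitionOf_add_single (n + Finsupp.single j 1) i
  rw [zee_partitionOf_add_single n j, mul_assoc] at h1
  have h2 := zee_partitionOf_add_single n (i + j)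
  have hz := zee_partitionOf_ne_zero n
  have hi := i.ne_zero
  have hj := j.ne_zero
  have e1 := scalar_natCast_inv_mul h1.symm hz (by positivity)
  have e2 := scalar_natCast_inv_mul h2.symm hz (by have := (i + j).ne_zero; positivity)
  rw [nsmul_eq_mul]
  have hsi : (n + Finsupp.single j 1 + Finsupp.single i 1 : ℕ+ →₀ ℕ) i =
    (n + Finsupp.single j 1 : ℕ+ →₀ ℕ) i + 1 := by simp
  have hsj : (n + Finsupp.single j 1 : ℕ+ →₀ ℕ) j = n j + 1 := by simp
  rw [hsi, hsj]
  push_cast at e1 e2 ⊢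
  linear_combination K * e2 - K * e1

end Coefficients

/-! ### Formal sums over pairs reduce to finite boxes. -/

section FormalSums

/-- The pairs `(i, j)` for which the monomial `m` can occur in the `(i, j)` cut-and-join term. -/
def pairBox (m : ℕ+ →₀ ℕ) : Finset (ℕ+ × ℕ+) :=
  Finset.Icc 1 (size m).succPNat ×ˢ Finset.Icc 1 (size m).succPNat

theorem mem_pairBox {m : ℕ+ →₀ ℕ} {ij : ℕ+ × ℕ+} :
    ij ∈ pairBox m ↔ (ij.1 : ℕ) ≤ size m + 1 ∧ (ij.2 : ℕ) ≤ size m + 1 := by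
  simp [pairBox, ← PNat.coe_le_coe]

theorem pairBox_mono {m n : ℕ+ →₀ ℕ} (h : m ≤ n) : pairBox m ⊆ pairBox n := by
  intro ij
  have := size_mono h
  rw [mem_pairBox, mem_pairBox]
  omega

theorem sum_pairBox {M : Type*} [AddCommMonoid M] (m : ℕ+ →₀ ℕ) (f : ℕ → ℕ → M) :
    ∑ ij ∈ pairBox m, f ij.1 ij.2 =
      ∑ i ∈ Finset.Icc 1 (size m + 1), ∑ j ∈ Finset.Icc 1 (size m + 1), f i j := by
  have h (F : ℕ → M) : ∑ i ∈ Finset.Icc 1 (size m).succPNat, F i =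
      ∑ i ∈ Finset.Icc 1 (size m + 1), F i := by
    have := PNat.map_subtype_embedding_Icc 1 (size m).succPNat
    rw [Nat.succPNat_coe, PNat.one_coe] at this
    exact (Finset.sum_map _ (Function.Embedding.subtype _) F).symm.trans
      (congrArg (fun s => ∑ i ∈ s, F i) this)
  rw [pairBox, Finset.sum_product]
  rw [← h]
  exact Finset.sum_congr rfl fun i _ => h _

theorem le_size {m : ℕ+ →₀ ℕ} {k : ℕ+} (h : m k ≠ 0) : (k : ℕ) ≤ size m := by
  obtain ⟨n, rfl⟩ := exists_eq_add_single h
  rw [size_add, size_single]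
  omega

theorem coeff_p_add_mul_eq_zero {m : ℕ+ →₀ ℕ} {ij : ℕ+ × ℕ+} (h : ij ∉ pairBox m) (F : PSeries) :
    MvPowerSeries.coeff m (p (ij.1 + ij.2) * F) = 0 := by
  refine coeff_p_mul_eq_zero (by_contra fun hk => h ?_) F
  have := le_size hk
  rw [PNat.add_coe] at this
  rw [mem_pairBox]
  omega

theorem coeff_p_mul_p_mul_eq_zero {m : ℕ+ →₀ ℕ} {ij : ℕ+ × ℕ+} (h : ij ∉ pairBox m) (F : PSeries) :
    MvPowerSeries.coeff m (p ij.1 * (p ij.2 * F)) = 0 := by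
  by_cases hi : m ij.1 = 0
  · exact coeff_p_mul_eq_zero hi _
  by_cases hj : m ij.2 = 0
  · rw [mul_left_comm]
    exact coeff_p_mul_eq_zero hj _
  have := le_size hi
  have := le_size hj
  rw [mem_pairBox] at h
  omega

/-- The terms in which the monomial `m` occurs are indexed by `pairBox m`. -/
def PairBounded (f : ℕ+ × ℕ+ → PSeries) : Prop :=
  ∀ m ij, ij ∉ pairBox m → MvPowerSeries.coeff m (f ij) = 0

theorem pairBounded_linearCutJoinTerm (F : PSeries) : PairBounded (linearCutJoinTerm F) := by
  intro m ij h
  rw [linearCutJoinTerm, ← Nat.cast_mul, ← Nat.cast_add]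
  simp only [mul_assoc]
  rw [map_add, coeff_natCast_mul, coeff_natCast_mul, coeff_p_add_mul_eq_zero h,
    coeff_p_mul_p_mul_eq_zero h]
  simp

theorem pairBounded_cutJoinTerm (F : PSeries) : PairBounded (cutJoinTerm F) := by
  intro m ij h
  rw [cutJoinTerm, ← Nat.cast_mul, ← Nat.cast_add]
  simp only [mul_assoc]
  rw [map_add, map_add, coeff_natCast_mul, coeff_natCast_mul, coeff_natCast_mul,
    coeff_p_add_mul_eq_zero h, coeff_p_add_mul_eq_zero h, coeff_p_mul_p_mul_eq_zero h]
  simp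

variable {f : ℕ+ × ℕ+ → PSeries}

theorem PairBounded.formallySummable (hf : PairBounded f) : FormallySummable f := by
  intro m
  refine (pairBox m).finite_toSet.subset fun ij hij => ?_
  by_contra h
  exact hij (hf m ij h)

/-- A larger `n` is allowed so that all factors of a product coefficient can share one box of pairs.
-/
theorem PairBounded.coeff_formalSum (hf : PairBounded f) {m n : ℕ+ →₀ ℕ} (h : m ≤ n) :
    MvPowerSeries.coeff m (formalSum f) = ∑ ij ∈ pairBox n, MvPowerSeries.coeff m (f ij) := by
  refine finsum_eq_sum_of_support_subset _ fun ij hij => ?_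
  by_contra h'
  exact hij (hf m ij fun h'' => h' (pairBox_mono h h''))

theorem PairBounded.mul_formalSum (hf : PairBounded f) {g : ℕ+ × ℕ+ → PSeries}
    (hg : PairBounded g) {F : PSeries} (h : ∀ ij, F * f ij = g ij) :
    F * formalSum f = formalSum g := by
  classical
  refine MvPowerSeries.ext fun m => ?_
  rw [hg.coeff_formalSum le_rfl, MvPowerSeries.coeff_mul]
  simp only [← h, MvPowerSeries.coeff_mul]
  rw [Finset.sum_comm]
  refine Finset.sum_congr rfl fun ab hab => ?_
  rw [hf.coeff_formalSum (n := m), Finset.mul_sum]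
  rw [← Finset.HasAntidiagonal.mem_antidiagonal.mp hab]
  exact le_add_self

end FormalSums

/-! ### The linear cut-and-join equation. -/

theorem dTauSeries_RBullet :
    dTauSeries RBullet = halfILam • formalSum (linearCutJoinTerm RBullet) := by
  refine MvPowerSeries.ext fun m => ?_
  have hd : size m ≤ size m + 1 := Nat.le_succ _
  rw [MvPowerSeries.coeff_smul, (pairBounded_linearCutJoinTerm RBullet).coeff_formalSum le_rfl]
  change dTau (weight (partitionOf m)) = _
  have h (ij : ℕ+ × ℕ+) := congrArg₂ (· + ·) (coeff_cut_RBullet m ij.1 ij.2)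
    (coeff_join_RBullet m ij.1 ij.2)
  simp only [← map_add, ← mul_add] at h
  simp only [linearCutJoinTerm, h]
  rw [sum_pairBox m (fun i j => scalar (zee (partitionOf m) : ℂ)⁻¹ *
      (((i + j) * (partitionOf m).parts.count (i + j)) •
          weightNumerator (size m) ((partitionOf m).parts - {i + j} + {i} + {j}) +
        (i * (partitionOf m).parts.count i * (j * ((partitionOf m).parts - {i}).count j)) •
          weightNumerator (size m) ((partitionOf m).parts - {i} - {j} + {i + j})))]
  rw [weight_partitionOf rfl, dTau_mul, dTau_scalar, mul_zero, add_zero,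
    dTau_weightNumerator (d := size m) (partitionOf m) hd]
  simp only [← Finset.mul_sum]
  rw [mul_left_comm]

/-! ### The constant term of `RBullet`. -/

section ConstantTerm

variable (ν : Nat.Partition 0)

theorem len_partition_zero : len ν = 0 := by
  simp [len, rows]

theorem V_partition_zero : V ν = 1 := by
  simp [V, len_partition_zero]

theorem expKappa_partition_zero : expKappa ν = 1 := by
  have : kappa ν = 0 := by simp [kappa, len_partition_zero]
  unfold expKappa
  rw [this]
  simp

/-- The group `S_0` is trivial, so the Young symmetrizer is `1` and generates the whole
one-dimensional group algebra. -/
theorem finrank_specht_partition_zero : Module.finrank ℂ (specht ν) = 1 := by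
  have hone : rowSymmetrizer ν * colAntisymmetrizer ν = 1 := by
    have h (g : Equiv.Perm (Fin 0)) : g = 1 := Subsingleton.elim _ _
    simp [rowSymmetrizer, colAntisymmetrizer, h, ← MonoidAlgebra.one_def]
  have hmem (x : MonoidAlgebra ℂ (Equiv.Perm (Fin 0))) : x ∈ specht ν := by
    rw [specht, hone, Ideal.span_singleton_one]
    exact Submodule.mem_top
  refine finrank_eq_one_iff'.mpr ⟨⟨1, hmem 1⟩, ?_, ?_⟩
  · intro h
    exact one_ne_zero (congrArg Subtype.val h)
  · rintro ⟨x, hx⟩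
    refine ⟨x.coeff 1, Subtype.ext ?_⟩
    refine MonoidAlgebra.ext (Finsupp.ext fun g => ?_)
    rw [Subsingleton.elim g 1]
    simp [MonoidAlgebra.one_def]

theorem constantCoeff_RBullet : MvPowerSeries.constantCoeff RBullet = 1 := by
  rw [← MvPowerSeries.coeff_zero_eq_constantCoeff_apply, coeff_RBullet,
    weight_partitionOf (d := 0) (by simp [size]), zee_partitionOf (s := ∅) 0 (by simp)]
  have hparts : (partitionOf 0).parts = (1 : Equiv.Perm (Fin 0)).partition.parts := by
    simp [partitionOf, Equiv.Perm.parts_partition]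
  have hchar (ν : Nat.Partition 0) : spechtChar ν 1 = 1 := by
    rw [spechtChar, map_one, LinearMap.trace_one, finrank_specht_partition_zero, Nat.cast_one]
  rw [weightNumerator, hparts]
  simp only [multisetChar_parts, hchar, V_partition_zero, expKappa_partition_zero]
  have hC : HahnSeries.map (1 : LaurentSeries ℂ) (Polynomial.C (R := ℂ)) = (1 : Coeff) := by
    refine HahnSeries.ext (funext fun n => ?_)
    rw [HahnSeries.map_coeff, HahnSeries.coeff_one, HahnSeries.coeff_one]
    split_ifs <;> simp
  simp [hC]

end ConstantTerm

/-! ### The logarithm of `RBullet` and the nonlinear equation. -/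

section Logarithm

/-- The part of `RBullet` without constant term. -/
def RReduced : PSeries := RBullet - 1

theorem RBullet_eq : RBullet = 1 + RReduced := by
  rw [RReduced]
  ring

theorem constantCoeff_RReduced : MvPowerSeries.constantCoeff RReduced = 0 := by
  rw [RReduced, map_sub, constantCoeff_RBullet, map_one, sub_self]

theorem coeff_RReduced {m : ℕ+ →₀ ℕ} (h : m ≠ 0) :
    MvPowerSeries.coeff m RReduced = weight (partitionOf m) := by
  classical
  rw [RReduced, map_sub, MvPowerSeries.coeff_one, if_neg h, sub_zero, coeff_RBullet]

theorem coeff_RReduced_pow_eq_zero {m : ℕ+ →₀ ℕ} {n : ℕ} (h : m.degree < n) :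
    MvPowerSeries.coeff m (RReduced ^ n) = 0 :=
  MvPowerSeries.coeff_eq_zero_of_constantCoeff_nilpotent (m := 1)
    (by rw [constantCoeff_RReduced, pow_one]) (by omega)

theorem coeff_RReduced_pow (m : ℕ+ →₀ ℕ) (n : ℕ) :
    MvPowerSeries.coeff m (RReduced ^ n) =
      ∑ t ∈ (Finset.piAntidiag (Finset.univ : Finset (Fin n)) m).filter (fun t => ∀ i, t i ≠ 0),
        ∏ i, weight (partitionOf (t i)) := by
  classical
  have h : RReduced ^ n = ∏ _i : Fin n, RReduced := by simp
  rw [h, MvPowerSeries.coeff_prod, Finset.sum_filter]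
  refine Finset.sum_bij' (fun l _ => ⇑l) (fun t _ => Finsupp.equivFunOnFinite.symm t) ?_ ?_ ?_ ?_ ?_
  · intro l hl
    rw [Finset.mem_finsuppAntidiag] at hl
    rw [Finset.mem_piAntidiag]
    exact ⟨hl.1, by simp⟩
  · intro t ht
    rw [Finset.mem_piAntidiag] at ht
    rw [Finset.mem_finsuppAntidiag]
    exact ⟨ht.1, by simp⟩
  · intro l _
    ext; simp
  · intro t _
    rfl
  · intro l _
    split_ifs with hl
    · exact Finset.prod_congr rfl fun i _ => coeff_RReduced (hl i)
    · push Not at hl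
      obtain ⟨i, hi⟩ := hl
      refine Finset.prod_eq_zero (Finset.mem_univ i) ?_
      rw [hi, MvPowerSeries.coeff_zero_eq_constantCoeff_apply, constantCoeff_RReduced]

/-- The truncated logarithm of `RBullet`. -/
def logTrunc (N : ℕ) : PSeries :=
  ∑ n ∈ Finset.Icc 1 N,
    MvPowerSeries.C (scalar ((-1 : ℂ) ^ (n - 1) / (n : ℂ))) * RReduced ^ n

/-- Powers of `RReduced` beyond the degree of `m` do not contribute, so every sufficiently long
truncation has the same coefficient. -/
theorem coeff_RSeries {m : ℕ+ →₀ ℕ} {N : ℕ} (h : m.degree ≤ N) :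
    MvPowerSeries.coeff m RSeries = MvPowerSeries.coeff m (logTrunc N) := by
  have h1 : MvPowerSeries.coeff m RSeries = ∑ n ∈ Finset.Icc 1 m.degree,
      scalar ((-1 : ℂ) ^ (n - 1) / (n : ℂ)) * MvPowerSeries.coeff m (RReduced ^ n) := by
    simp only [coeff_RReduced_pow, ← smul_eq_scalar_mul]
    rfl
  rw [h1, logTrunc, map_sum]
  simp only [MvPowerSeries.coeff_C_mul]
  refine Finset.sum_subset (Finset.Icc_subset_Icc_right h) fun n hn hn' => ?_
  rw [Finset.mem_Icc] at hn hn'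
  rw [coeff_RReduced_pow_eq_zero (by omega), mul_zero]

/-- A derivation of the power series ring that kills the complex numbers and whose values have
coefficients that depend on finitely many degrees. -/
structure IsLocalDerivation (D : PSeries → PSeries) : Prop where
  map_add : ∀ F G, D (F + G) = D F + D G
  map_mul : ∀ F G, D (F * G) = F * D G + G * D F
  map_scalar : ∀ c : ℂ, D (MvPowerSeries.C (scalar c)) = 0
  congr_coeff : ∀ (m : ℕ+ →₀ ℕ) F G, (∀ b : ℕ+ →₀ ℕ, b.degree ≤ m.degree + 1 →
    MvPowerSeries.coeff b F = MvPowerSeries.coeff b G) →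
    MvPowerSeries.coeff m (D F) = MvPowerSeries.coeff m (D G)

namespace IsLocalDerivation

variable {D : PSeries → PSeries}

theorem map_zero (hD : IsLocalDerivation D) : D 0 = 0 := by
  have := hD.map_add 0 0
  rw [add_zero] at this
  exact left_eq_add.mp this

theorem map_one (hD : IsLocalDerivation D) : D 1 = 0 := by
  have := hD.map_scalar 1
  rwa [_root_.map_one, _root_.map_one] at this

theorem map_sum (hD : IsLocalDerivation D) {ι : Type*} (s : Finset ι) (f : ι → PSeries) :
    D (∑ i ∈ s, f i) = ∑ i ∈ s, D (f i) :=
  _root_.map_sum (⟨⟨D, hD.map_zero⟩, hD.map_add⟩ : PSeries →+ PSeries) f s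

theorem map_pow_succ (hD : IsLocalDerivation D) (F : PSeries) (n : ℕ) :
    D (F ^ (n + 1)) = ((n + 1 : ℕ) : PSeries) * F ^ n * D F := by
  induction n with
  | zero => simp
  | succ n ih =>
    rw [pow_succ, hD.map_mul, ih]
    push_cast
    ring

/-- Differentiating the truncated logarithm gives a geometric sum in `-RReduced`; multiplication by
`1 + RReduced` telescopes it. -/
theorem map_logTrunc (hD : IsLocalDerivation D) (N : ℕ) :
    RBullet * D (logTrunc N) = D RBullet - (-RReduced) ^ N * D RBullet := by
  have h1 : D RBullet = D RReduced := by
    rw [RBullet_eq, hD.map_add, hD.map_one, zero_add]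
  have h2 : D (logTrunc N) = (∑ n ∈ Finset.range N, (-RReduced) ^ n) * D RReduced := by
    rw [logTrunc, hD.map_sum, Finset.sum_mul]
    refine Finset.sum_nbij' (· - 1) (· + 1) ?_ ?_ ?_ ?_ ?_
    · intro n hn
      rw [Finset.mem_Icc] at hn
      rw [Finset.mem_range]
      omega
    · intro n hn
      rw [Finset.mem_range] at hn
      rw [Finset.mem_Icc]
      omega
    · intro n hn
      rw [Finset.mem_Icc] at hn
      omega
    · intro n _
      rfl
    · intro n hn
      rw [Finset.mem_Icc] at hn
      obtain ⟨k, rfl⟩ : ∃ k, n = k + 1 := ⟨n - 1, by omega⟩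
      have hk : ((k + 1 : ℕ) : PSeries) *
          MvPowerSeries.C (scalar ((-1 : ℂ) ^ k / ((k + 1 : ℕ) : ℂ))) = (-1) ^ k := by
        have : ((k + 1 : ℕ) : PSeries) = MvPowerSeries.C (scalar ((k + 1 : ℕ) : ℂ)) := by
          rw [map_natCast, map_natCast]
        rw [this, ← _root_.map_mul, ← _root_.map_mul,
          mul_div_cancel₀ _ (Nat.cast_ne_zero.mpr k.succ_ne_zero)]
        simp
      rw [hD.map_mul, hD.map_scalar, mul_zero, add_zero, hD.map_pow_succ, Nat.add_sub_cancel,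
        neg_pow RReduced, ← hk]
      ring
  rw [h1, h2, ← mul_assoc, RBullet_eq]
  have := mul_neg_geom_sum (-RReduced) N
  rw [sub_neg_eq_add] at this
  rw [this]
  ring

theorem RBullet_mul_map_RSeries (hD : IsLocalDerivation D) : RBullet * D RSeries = D RBullet := by
  classical
  refine MvPowerSeries.ext fun m => ?_
  -- The truncation exceeds the degree of `m` by one because `D` may look one degree higher; the
  -- same exponent kills the telescoping remainder in `h2`.
  have h1 : MvPowerSeries.coeff m (RBullet * D RSeries) =
      MvPowerSeries.coeff m (RBullet * D (logTrunc (m.degree + 1))) := by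
    rw [MvPowerSeries.coeff_mul, MvPowerSeries.coeff_mul]
    refine Finset.sum_congr rfl fun ab hab => ?_
    rw [Finset.HasAntidiagonal.mem_antidiagonal] at hab
    congr 1
    refine hD.congr_coeff _ _ _ fun b hb => coeff_RSeries (hb.trans ?_)
    rw [← hab, _root_.map_add]
    omega
  have h2 : MvPowerSeries.coeff m ((-RReduced) ^ (m.degree + 1) * D RBullet) = 0 := by
    rw [MvPowerSeries.coeff_mul]
    refine Finset.sum_eq_zero fun ab hab => ?_
    rw [Finset.HasAntidiagonal.mem_antidiagonal] at hab
    have : ab.1.degree < m.degree + 1 := by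
      rw [← hab, _root_.map_add]
      omega
    have h := coeff_RReduced_pow_eq_zero this
    rw [neg_pow RReduced]
    rcases neg_one_pow_eq_or PSeries (m.degree + 1) with h' | h' <;> rw [h'] <;> simp [h]
  rw [h1, hD.map_logTrunc, _root_.map_sub, h2, sub_zero]

end IsLocalDerivation

theorem isLocalDerivation_dP (i : ℕ+) : IsLocalDerivation (dP i) where
  map_add := map_add (MvPowerSeries.pderiv Coeff i)
  map_mul F G := by
    simp only [dP, Derivation.leibniz, smul_eq_mul]
  map_scalar c := MvPowerSeries.pderiv_C
  congr_coeff m F G h := by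
    rw [coeff_dP, coeff_dP, h _ (by simp)]

theorem coeff_dTauSeries (m : ℕ+ →₀ ℕ) (F : PSeries) :
    MvPowerSeries.coeff m (dTauSeries F) = dTau (MvPowerSeries.coeff m F) := rfl

theorem isLocalDerivation_dTauSeries : IsLocalDerivation dTauSeries where
  map_add F G := by
    refine MvPowerSeries.ext fun m => ?_
    simp only [coeff_dTauSeries, map_add, dTau_add]
  map_mul F G := by
    classical
    refine MvPowerSeries.ext fun m => ?_
    rw [mul_comm G, map_add, coeff_dTauSeries, MvPowerSeries.coeff_mul, MvPowerSeries.coeff_mul,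
      MvPowerSeries.coeff_mul, dTau_sum, ← Finset.sum_add_distrib]
    refine Finset.sum_congr rfl fun ab _ => ?_
    rw [dTau_mul, coeff_dTauSeries, coeff_dTauSeries]
    ring
  map_scalar c := by
    classical
    refine MvPowerSeries.ext fun m => ?_
    rw [coeff_dTauSeries, MvPowerSeries.coeff_C]
    split_ifs
    · rw [dTau_scalar, map_zero]
    · rw [dTau_zero, map_zero]
  congr_coeff m F G h := by
    rw [coeff_dTauSeries, coeff_dTauSeries, h m (Nat.le_succ _)]

/-- Applying `∂/∂p_i` to `R^• ∂R/∂p_j = ∂R^•/∂p_j` produces the quadratic term: the second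
derivative of an exponential. -/
theorem RBullet_mul_cutJoinTerm (ij : ℕ+ × ℕ+) :
    RBullet * cutJoinTerm RSeries ij = linearCutJoinTerm RBullet ij := by
  have h (i : ℕ+) := (isLocalDerivation_dP i).RBullet_mul_map_RSeries
  have h2 : RBullet * dP ij.1 (dP ij.2 RSeries) + RBullet * (dP ij.1 RSeries * dP ij.2 RSeries) =
      dP ij.1 (dP ij.2 RBullet) := by
    rw [← h ij.2, (isLocalDerivation_dP ij.1).map_mul, ← h ij.1]
    ring
  rw [cutJoinTerm, linearCutJoinTerm, ← h2, ← h (ij.1 + ij.2)]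
  ring

theorem dTauSeries_RSeries :
    dTauSeries RSeries = halfILam • formalSum (cutJoinTerm RSeries) := by
  have hunit : IsUnit RBullet := by
    rw [MvPowerSeries.isUnit_iff_constantCoeff, constantCoeff_RBullet]
    exact isUnit_one
  refine hunit.mul_left_cancel ?_
  rw [isLocalDerivation_dTauSeries.RBullet_mul_map_RSeries, dTauSeries_RBullet, mul_smul_comm,
    (pairBounded_cutJoinTerm RSeries).mul_formalSum (pairBounded_linearCutJoinTerm RBullet)
      RBullet_mul_cutJoinTerm]

end Logarithm

end

end MarinoVafa

theorem theorem1 :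
    (MarinoVafa.FormallySummable (MarinoVafa.cutJoinTerm MarinoVafa.RSeries) ∧
      MarinoVafa.dTauSeries MarinoVafa.RSeries =
        MarinoVafa.halfILam •
          MarinoVafa.formalSum (MarinoVafa.cutJoinTerm MarinoVafa.RSeries)) ∧
    (MarinoVafa.FormallySummable (MarinoVafa.linearCutJoinTerm MarinoVafa.RBullet) ∧
      MarinoVafa.dTauSeries MarinoVafa.RBullet =
        MarinoVafa.halfILam •
          MarinoVafa.formalSum (MarinoVafa.linearCutJoinTerm MarinoVafa.RBullet)) :=
  ⟨⟨(MarinoVafa.pairBounded_cutJoinTerm _).formallySummable, MarinoVafa.dTauSeries_RSeries⟩,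
    (MarinoVafa.pairBounded_linearCutJoinTerm _).formallySummable, MarinoVafa.dTauSeries_RBullet⟩
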